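/- Let $V\in\mathbb R\setminus\{0\}$, $A_\pm>0$, $\delta\in\mathbb R$, $p_\pm=\mp V/2+iA_\pm$, let $\Sigma_\pm=[\overline{p_\pm},p_\pm]$ be the vertical segments, oriented upward, and let $\Sigma=\mathbb R\cup\Sigma_+\cup\Sigma_-$ with $\mathbb R$ oriented from left to right. Superscripts $\pm$ denote the boundary values from the left/right of the oriented contour. Write $\Sigma_{\pm1}^o$ and $\Sigma_{\pm2}^o$ for the open segments $\mp V/2+i(0,A_\pm)$ and $\mp V/2+i(-A_\pm,0)$. Let $\rho$ be a complex function on $\mathbb R\cup\Sigma_{+1}^o$ without zeros on $\Sigma_{+1}^o$, let $r$ be a complex function on $\Sigma_{-1}^o$, let $K=\{k_1,\dots,k_N\}\subset\mathbb C^+\setminus\Sigma$ be a finite set of distinct points ($N\ge 0$), $c_1,\dots,c_N\in\mathbb C$, $\overline K=\{\overline{k_1},\dots,\overline{k_N}\}$. Fix $x,t\in\mathbb R$ and put $\theta_o(k)=k(x-2kt)$, $\sigma_3=\mathrm{diag}(1,-1)$, $J(k)=e^{i\theta_o(k)\sigma_3}J_o(k)e^{-i\theta_o(k)\sigma_3}$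 with $$J_o(k)=\begin{pmatrix}1&\rho(k)\\ \overline{\rho(k)}&1+\rho(k)\overline{\rho(k)}\end{pmatrix}\ (k\in\mathbb R),\quad \begin{pmatrix}i\rho(k)e^{-i\delta}&0\\-ie^{-i\delta}&-ie^{i\delta}/\rho(k)\end{pmatrix}\ (k\in\Sigma_{+1}^o),\quad \begin{pmatrix}ie^{-i\delta}/\overline{\rho(\overline k)}&-ie^{i\delta}\\0&-i\overline{\rho(\overline k)}e^{i\delta}\end{pmatrix}\ (k\in\Sigma_{+2}^o),$$ $$J_o(k)=\begin{pmatrix}1&-r(k)\\0&1\end{pmatrix}\ (k\in\Sigma_{-1}^o),\quad \begin{pmatrix}1&0\\ \overline{r(\overline k)}&1\end{pmatrix}\ (k\in\Sigma_{-2}^o).$$ Suppose that the $2\times2$ matrix function $M(k)=(M_1(k),M_2(k))$, with columns $M_1,M_2$, solves the following Riemann--Hilbert problem. (i) $M$ is analytic in $\mathbb C\setminus(\Sigma\cup K\cup\overline K)$. (ii) $M$ extends continuously from each side to $\Sigma$ away from the four branch points $p_\pm,\overline{p_\pm}$ and the two crossing points $\pm V/2$, its boundary values $M^\pm$ satisfy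 $M^+=M^-J$ there, and $M$ is bounded near $\pm V/2$. (iii) $M(k)=I+O(1/k)$ as $k\to\infty$, $k\notin\Sigma$. (iv) At each $k_n$ the column $M_1$ is analytic and $M_2$ has at most a simple pole, with residue $c_ne^{2i\theta_o(k_n)}M_1(k_n)$; at each $\overline{k_n}$ the column $M_2$ is analytic and $M_1$ has at most a simple pole, with residue $-\overline{c_n}e^{-2i\theta_o(\overline{k_n})}M_2(\overline{k_n})$. (v) As $k$ tends, off $\Sigma$, to the respective branch point, the limits $\lim_{k\to p_+}M(k)(k-p_+)^{\sigma_3/4}$, $\lim_{k\to\overline{p_+}}M(k)(k-\overline{p_+})^{-\sigma_3/4}$, $\lim_{k\to p_-}M(k)$ and $\lim_{k\to\overline{p_-}}M(k)$ exist, where the fourth roots are cut, near the branch point, along $\Sigma_+$. Then all the integrals below converge absolutely, and $M$ satisfies the linear algebraic-integral system $$M(k)=I+\sum_{n=1}^N\Big(\frac{-\overline{c_n}e^{-2i\theta_o(\overline{k_n})}M_2(\overline{k_n})}{k-\overline{k_n}},\ \frac{c_ne^{2i\theta_o(k_n)}M_1(k_n)}{k-k_n}\Big)+\frac1{2\pi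 i}\int_\Sigma\frac{M^-(\xi)(J(\xi)-I)}{\xi-k}\,d\xi,\quad k\in\mathbb C\setminus(\Sigma\cup K\cup\overline K),$$ and, for $n=1,\dots,N$, with $[\,\cdot\,]_j$ denoting the $j$-th column, $$M_1(k_n)=\begin{pmatrix}1\\0\end{pmatrix}-\sum_{m=1}^N\frac{\overline{c_m}e^{-2i\theta_o(\overline{k_m})}M_2(\overline{k_m})}{k_n-\overline{k_m}}+\frac1{2\pi i}\int_\Sigma\frac{[M^-(\xi)(J(\xi)-I)]_1}{\xi-k_n}\,d\xi,$$ $$M_2(\overline{k_n})=\begin{pmatrix}0\\1\end{pmatrix}+\sum_{m=1}^N\frac{c_me^{2i\theta_o(k_m)}M_1(k_m)}{\overline{k_n}-k_m}+\frac1{2\pi i}\int_\Sigma\frac{[M^-(\xi)(J(\xi)-I)]_2}{\xi-\overline{k_n}}\,d\xi.$$ -/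

import Mathlib

open Filter Topology Asymptotics MeasureTheory
open scoped ComplexConjugate

noncomputable section

namespace PlaneWaveRHP

/-- The data of the Riemann-Hilbert problem: the velocity `V`, the amplitudes `Ap`, `Am`
(for `x → +∞` and `x → -∞`), the phase `δ`, the reflection coefficients `ρ` and `r`
(only their values on `ℝ ∪ Σ₊₁ᵒ`, respectively `Σ₋₁ᵒ`, are ever used),
the discrete eigenvalues `ev n` in the upper half plane and the norming constants `c n`. -/
structure Data where
  V : ℝ
  Ap : ℝ
  Am : ℝ
  δ : ℝ
  ρ : ℂ → ℂ
  r : ℂ → ℂ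
  N : ℕ
  ev : Fin N → ℂ
  c : Fin N → ℂ

namespace Data

variable (D : Data)

/-- The upper branch point `p₊ = -V/2 + i A₊`. -/
def pPlus : ℂ := -(D.V / 2 : ℂ) + Complex.I * D.Ap

/-- The upper branch point `p₋ = V/2 + i A₋`. -/
def pMinus : ℂ := (D.V / 2 : ℂ) + Complex.I * D.Am

/-- The branch cut `Σ₊`, the closed segment from `conj p₊` to `p₊`. -/
def sigmaPlus : Set ℂ := {z | z.re = -(D.V / 2) ∧ |z.im| ≤ D.Ap}

/-- The branch cut `Σ₋`, the closed segment from `conj p₋` to `p₋`. -/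
def sigmaMinus : Set ℂ := {z | z.re = D.V / 2 ∧ |z.im| ≤ D.Am}

/-- The contour `Σ = ℝ ∪ Σ₊ ∪ Σ₋`. -/
def sigma : Set ℂ := {z | z.im = 0} ∪ D.sigmaPlus ∪ D.sigmaMinus

/-- The open upper half `Σ₊₁ᵒ` of `Σ₊`. -/
def sigmaPlus1 : Set ℂ := {z | z.re = -(D.V / 2) ∧ 0 < z.im ∧ z.im < D.Ap}

/-- The open lower half `Σ₊₂ᵒ` of `Σ₊`. -/
def sigmaPlus2 : Set ℂ := {z | z.re = -(D.V / 2) ∧ -D.Ap < z.im ∧ z.im < 0}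

/-- The open upper half `Σ₋₁ᵒ` of `Σ₋`. -/
def sigmaMinus1 : Set ℂ := {z | z.re = D.V / 2 ∧ 0 < z.im ∧ z.im < D.Am}

/-- The open lower half `Σ₋₂ᵒ` of `Σ₋`. -/
def sigmaMinus2 : Set ℂ := {z | z.re = D.V / 2 ∧ -D.Am < z.im ∧ z.im < 0}

/-- The real line without the points `±V/2` where the contour crosses itself. -/
def realPart : Set ℂ := {z | z.im = 0 ∧ z.re ≠ -(D.V / 2) ∧ z.re ≠ D.V / 2}

/-- The open vertical pieces of the contour. -/
def cuts : Set ℂ := D.sigmaPlus1 ∪ D.sigmaPlus2 ∪ D.sigmaMinus1 ∪ D.sigmaMinus2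

/-- The discrete spectrum `K ∪ conj K`. -/
def spec : Set ℂ := Set.range D.ev ∪ Set.range (fun n => conj (D.ev n))

/-- Standing assumptions: nonzero velocity, positive amplitudes, a reflection coefficient `ρ` without
zeros on `Σ₊₁ᵒ` (so that the jump matrix is defined), and pairwise distinct eigenvalues
in the upper half plane off the contour. -/
structure Admissible : Prop where
  V_ne : D.V ≠ 0
  Ap_pos : 0 < D.Ap
  Am_pos : 0 < D.Am
  ρ_ne : ∀ z ∈ D.sigmaPlus1, D.ρ z ≠ 0
  ev_injective : Function.Injective D.ev
  ev_im_pos : ∀ n, 0 < (D.ev n).im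
  ev_notMem : ∀ n, D.ev n ∉ D.sigma

end Data

/-- The phase `θ_o(x,t,k) = k (x - 2 k t)`. -/
def theta (x t : ℝ) (k : ℂ) : ℂ := k * (x - 2 * k * t)

/-- The matrix `exp(i w σ₃)`. -/
def expSigma3 (w : ℂ) : Matrix (Fin 2) (Fin 2) ℂ :=
  !![Complex.exp (Complex.I * w), 0; 0, Complex.exp (-(Complex.I * w))]

open Classical in
/-- The jump matrix `J_o(k)` (the value off the contour is irrelevant). -/
def Data.jumpO (D : Data) (k : ℂ) : Matrix (Fin 2) (Fin 2) ℂ :=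
  if k.im = 0 then
    !![1, D.ρ k; conj (D.ρ k), 1 + D.ρ k * conj (D.ρ k)]
  else if k ∈ D.sigmaPlus1 then
    !![Complex.I * D.ρ k * Complex.exp (-(Complex.I * D.δ)), 0;
       -Complex.I * Complex.exp (-(Complex.I * D.δ)),
         -Complex.I * Complex.exp (Complex.I * D.δ) / D.ρ k]
  else if k ∈ D.sigmaPlus2 then
    !![Complex.I * Complex.exp (-(Complex.I * D.δ)) / conj (D.ρ (conj k)),
         -Complex.I * Complex.exp (Complex.I * D.δ);
       0, -Complex.I * conj (D.ρ (conj k)) * Complex.exp (Complex.I * D.δ)]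
  else if k ∈ D.sigmaMinus1 then
    !![1, -D.r k; 0, 1]
  else if k ∈ D.sigmaMinus2 then
    !![1, 0; conj (D.r (conj k)), 1]
  else 1

/-- The jump matrix `J(x,t,k) = exp(iθ_oσ₃) J_o(k) exp(-iθ_oσ₃)`. -/
def Data.jump (D : Data) (x t : ℝ) (k : ℂ) : Matrix (Fin 2) (Fin 2) ℂ :=
  expSigma3 (theta x t k) * D.jumpO k * expSigma3 (-theta x t k)

/-- The fourth root `r^{1/4} e^{iφ/4}` of `r e^{iφ}`, `-π/2 < φ < 3π/2`,
with branch cut along the negative imaginary axis. -/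
def rootDown (z : ℂ) : ℂ :=
  Complex.exp (Complex.I * (Real.pi / 8 : ℝ)) * (-Complex.I * z) ^ (1 / 4 : ℂ)

/-- The reflected fourth root, with branch cut along the positive imaginary axis. -/
def rootUp (z : ℂ) : ℂ := conj (rootDown (conj z))

/-- `M` solves the Riemann-Hilbert problem at `(x,t)`, and `Mp`, `Mm` are its boundary values
from the left and from the right of the contour. The real line is oriented from left to right
and the cuts `Σ₊`, `Σ₋` upwards. Values of `M` on the contour are never used. -/
structure IsSolution (D : Data) (x t : ℝ) (M Mp Mm : ℂ → Matrix (Fin 2) (Fin 2) ℂ) : Prop where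
  /-- analyticity off the contour and the discrete spectrum -/
  analytic : ∀ i j, AnalyticOnNhd ℂ (fun k => M k i j) (D.sigma ∪ D.spec)ᶜ
  /-- `M` extends continuously to the real line, from above and from below -/
  left_real : ∀ k ∈ D.realPart, Tendsto M (𝓝[{w | 0 < w.im}] k) (𝓝 (Mp k))
  right_real : ∀ k ∈ D.realPart, Tendsto M (𝓝[{w | w.im < 0}] k) (𝓝 (Mm k))
  /-- `M` extends continuously to the cuts, from the left and from the right -/
  left_cuts : ∀ k ∈ D.cuts, Tendsto M (𝓝[{w | w.re < k.re}] k) (𝓝 (Mp k))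
  right_cuts : ∀ k ∈ D.cuts, Tendsto M (𝓝[{w | k.re < w.re}] k) (𝓝 (Mm k))
  /-- `M` stays bounded at the two self-intersections of the contour -/
  crossing : ∀ q ∈ ({-(D.V / 2 : ℂ), (D.V / 2 : ℂ)} : Set ℂ),
    ∃ B : ℝ, ∀ᶠ k in 𝓝[D.sigmaᶜ] q, ∀ i j, ‖M k i j‖ ≤ B
  /-- the jump condition -/
  jump : ∀ k ∈ D.realPart ∪ D.cuts, Mp k = Mm k * D.jump x t k
  /-- the normalization `M = I + O(1/k)` as `k → ∞` -/
  normalization : ∀ i j, (fun k => M k i j - (1 : Matrix (Fin 2) (Fin 2) ℂ) i j)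
    =O[Bornology.cobounded ℂ ⊓ 𝓟 D.sigmaᶜ] (fun k => k⁻¹)
  /-- at `k_n` the first column is regular, and the second one has at most a simple pole with residue
  `c_n e^{2iθ_o(k_n)} M₁(k_n)` -/
  regular_ev : ∀ n i, AnalyticAt ℂ (fun k => M k i 0) (D.ev n)
  residue_ev : ∀ n i, Tendsto (fun k => (k - D.ev n) * M k i 1) (𝓝[≠] (D.ev n))
    (𝓝 (D.c n * Complex.exp (2 * Complex.I * theta x t (D.ev n)) * M (D.ev n) i 0))
  /-- at `conj k_n` the second column is regular, and the first one has at most a simple pole with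
  residue `-conj c_n e^{-2iθ_o(conj k_n)} M₂(conj k_n)` -/
  regular_conj : ∀ n i, AnalyticAt ℂ (fun k => M k i 1) (conj (D.ev n))
  residue_conj : ∀ n i, Tendsto (fun k => (k - conj (D.ev n)) * M k i 0) (𝓝[≠] (conj (D.ev n)))
    (𝓝 (-conj (D.c n) * Complex.exp (-(2 * Complex.I * theta x t (conj (D.ev n))))
      * M (conj (D.ev n)) i 1))
  /-- the growth conditions: existence of the limits at the four branch points -/
  growth_pPlus : ∃ L, Tendsto (fun k => M k *
      !![rootDown (k - D.pPlus), 0; 0, (rootDown (k - D.pPlus))⁻¹])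
    (𝓝[D.sigmaᶜ] D.pPlus) (𝓝 L)
  growth_pPlus_conj : ∃ L, Tendsto (fun k => M k *
      !![(rootUp (k - conj D.pPlus))⁻¹, 0; 0, rootUp (k - conj D.pPlus)])
    (𝓝[D.sigmaᶜ] (conj D.pPlus)) (𝓝 L)
  growth_pMinus : ∃ L, Tendsto M (𝓝[D.sigmaᶜ] D.pMinus) (𝓝 L)
  growth_pMinus_conj : ∃ L, Tendsto M (𝓝[D.sigmaᶜ] (conj D.pMinus)) (𝓝 L)

/-- Absolute integrability of `f` along the contour `Σ`. -/
def Data.ContourIntegrable (D : Data) (f : ℂ → ℂ) : Prop :=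
  Integrable (fun s : ℝ => f s) ∧
  IntervalIntegrable (fun s : ℝ => f (-(D.V / 2 : ℂ) + Complex.I * s)) volume (-D.Ap) D.Ap ∧
  IntervalIntegrable (fun s : ℝ => f ((D.V / 2 : ℂ) + Complex.I * s)) volume (-D.Am) D.Am

/-- The integral `∫_Σ f(ξ) dξ` along the oriented contour. -/
def Data.contourIntegral (D : Data) (f : ℂ → ℂ) : ℂ :=
  (∫ s : ℝ, f s) +
  (∫ s in (-D.Ap)..D.Ap, f (-(D.V / 2 : ℂ) + Complex.I * s) * Complex.I) +
  (∫ s in (-D.Am)..D.Am, f ((D.V / 2 : ℂ) + Complex.I * s) * Complex.I)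

/-- The `(i,j)` entry of `M⁻(ξ) (J(ξ) - I) / (ξ - k)`. -/
def Data.kernel (D : Data) (x t : ℝ) (Mm : ℂ → Matrix (Fin 2) (Fin 2) ℂ) (k : ℂ) (i j : Fin 2)
    (ξ : ℂ) : ℂ :=
  (Mm ξ * (D.jump x t ξ - 1)) i j / (ξ - k)

/-- The matrix `(1/2πi) ∫_Σ M⁻(ξ) (J(ξ) - I) / (ξ - k) dξ`, integrated entry by entry. -/
def Data.cauchy (D : Data) (x t : ℝ) (Mm : ℂ → Matrix (Fin 2) (Fin 2) ℂ) (k : ℂ) :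
    Matrix (Fin 2) (Fin 2) ℂ :=
  Matrix.of fun i j =>
    (2 * Real.pi * Complex.I)⁻¹ * D.contourIntegral (D.kernel x t Mm k i j)

/-- The coefficient `c_n e^{2iθ_o(k_n)}`. -/
def Data.coeff (D : Data) (x t : ℝ) (n : Fin D.N) : ℂ :=
  D.c n * Complex.exp (2 * Complex.I * theta x t (D.ev n))

/-- The coefficient `conj c_n e^{-2iθ_o(conj k_n)}`. -/
def Data.coeffConj (D : Data) (x t : ℝ) (n : Fin D.N) : ℂ :=
  conj (D.c n) * Complex.exp (-(2 * Complex.I * theta x t (conj (D.ev n))))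

end PlaneWaveRHP

end

/-! Each entry of `M` is holomorphic off the contour up to finitely many simple poles. It is
therefore the sum of its value at infinity, its principal parts and the Cauchy integral of its jump,
and by the jump condition that jump is an entry of `M⁻(J - I)`. The residue conditions express the
principal parts of one column through values of the other. Since the first column has no pole at
`k_n` and the second has none at `conj k_n`, the formula may be evaluated there, and this closes the
system.

The work lies in Cauchy's formula on an unbounded, self-intersecting contour with singular points.
No indentation is used. The real line and the two full vertical lines through `±V/2` cut the plane
into six open rectangles, and Cauchy's theorem on each is obtained from closed inner rectangles by
dominated convergence (`integral_boundary_rect_eq_zero`). The growth conditions allow at most `|z -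
p|^(-1/4)` at the branch points. With a decay `(1 + |z|)⁻²` this gives integrable majorants uniform
over all horizontal, respectively all vertical, lines. Summing the cells shows that the jumps have
total integral zero (`Data.contourIntegral_jump_eq_zero`), and absolute convergence comes with the
limit.

For Cauchy's formula at `k` (`Data.cauchy_of_norm_le`) one subtracts from `f = O(1/z)` the function
equal to `c / (z - conj k)` on the half plane of `k` and to zero on the other, with `c` chosen so
that the difference vanishes at `k`. Division by `z - k` then leaves no pole and a decay of order
`z⁻²`, while the added jump lives on the real line and is a multiple of the Poisson kernel. Removing
the constant at infinity and the principal parts reduces the general case to this one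
(`Data.cauchy_of_simple_poles`). -/

noncomputable section

namespace PlaneWaveRHP

/-! ### Cauchy's theorem on open rectangles with dominated boundary values -/

/-- The intervals `[a n, b n]` lie in `S` and exhaust it. -/
structure Exhausts (S : Set ℝ) (a b : ℕ → ℝ) : Prop where
  le : ∀ n, a n ≤ b n
  subset : ∀ n, Set.Icc (a n) (b n) ⊆ S
  eventually_mem : ∀ s ∈ S, ∀ᶠ n in atTop, s ∈ Set.Ioc (a n) (b n)

/-- Dominated convergence for the integrands cut off to `(a n, b n]`. The integrand varies together
with the interval because a side of the inner rectangle approaches the boundary while it grows. -/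
theorem Exhausts.tendsto_integral {S : Set ℝ} {a b : ℕ → ℝ} (h : Exhausts S a b)
    (hS : MeasurableSet S) {F : ℕ → ℝ → ℂ} {F' : ℝ → ℂ} {g : ℝ → ℝ}
    (hF : ∀ n, ContinuousOn (F n) S) (hg : IntegrableOn g S)
    (hb : ∀ᵐ (s : ℝ) ∂volume.restrict S, ∀ n, ‖F n s‖ ≤ g s)
    (hlim : ∀ᵐ (s : ℝ) ∂volume.restrict S, Tendsto (fun n => F n s) atTop (𝓝 (F' s))) :
    IntegrableOn F' S ∧
      Tendsto (fun n => ∫ s in (a n)..(b n), F n s) atTop (𝓝 (∫ s in S, F' s)) := by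
  have hm : ∀ n, AEStronglyMeasurable (F n) (volume.restrict S) := fun n =>
    (hF n).aestronglyMeasurable hS
  refine ⟨?_, ?_⟩
  · refine Integrable.mono' hg (aestronglyMeasurable_of_tendsto_ae atTop hm hlim) ?_
    filter_upwards [hb, hlim] with s h1 h2
    exact le_of_tendsto h2.norm (Eventually.of_forall h1)
  · have key : ∀ n, ∫ s in (a n)..(b n), F n s
        = ∫ s in S, (Set.Ioc (a n) (b n)).indicator (F n) s := by
      intro n
      rw [intervalIntegral.integral_of_le (h.le n), setIntegral_indicator measurableSet_Ioc,
        Set.inter_eq_right.2 (Set.Ioc_subset_Icc_self.trans (h.subset n))]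
    simp_rw [key]
    refine tendsto_integral_of_dominated_convergence g
      (fun n => (hm n).indicator measurableSet_Ioc) hg ?_ ?_
    · intro n
      filter_upwards [hb] with s h1
      exact (norm_indicator_le_norm_self _ _).trans (h1 n)
    · filter_upwards [hlim, ae_restrict_mem hS] with s h1 h2
      refine h1.congr' ?_
      filter_upwards [h.eventually_mem s h2] with n hn
      rw [Set.indicator_of_mem hn]

/-- Cauchy's theorem for an open, possibly unbounded rectangle `S × T` and a function with
dominated boundary values. -/
theorem integral_boundary_rect_eq_zero {S T : Set ℝ} {a b c d : ℕ → ℝ}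
    (hab : Exhausts S a b) (hcd : Exhausts T c d) (hS : MeasurableSet S) (hT : MeasurableSet T)
    {f : ℂ → ℂ} (hf : DifferentiableOn ℂ f (S ×ℂ T)) {g h : ℝ → ℝ}
    (hg : IntegrableOn g S) (hh : IntegrableOn h T)
    (bg : ∀ᵐ (s : ℝ) ∂volume.restrict S, ∀ y ∈ T, ‖f (s + y * Complex.I)‖ ≤ g s)
    (bh : ∀ᵐ (y : ℝ) ∂volume.restrict T, ∀ s ∈ S, ‖f (s + y * Complex.I)‖ ≤ h y)
    {fb ft fl fr : ℝ → ℂ}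
    (lb : ∀ᵐ (s : ℝ) ∂volume.restrict S, Tendsto (fun n => f (s + c n * Complex.I)) atTop (𝓝 (fb s)))
    (lt : ∀ᵐ (s : ℝ) ∂volume.restrict S, Tendsto (fun n => f (s + d n * Complex.I)) atTop (𝓝 (ft s)))
    (ll : ∀ᵐ (y : ℝ) ∂volume.restrict T, Tendsto (fun n => f (a n + y * Complex.I)) atTop (𝓝 (fl y)))
    (lr : ∀ᵐ (y : ℝ) ∂volume.restrict T, Tendsto (fun n => f (b n + y * Complex.I)) atTop (𝓝 (fr y))) :
    (IntegrableOn fb S ∧ IntegrableOn ft S ∧ IntegrableOn fl T ∧ IntegrableOn fr T) ∧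
    (∫ s in S, fb s) - (∫ s in S, ft s) + Complex.I * (∫ y in T, fr y)
      - Complex.I * (∫ y in T, fl y) = 0 := by
  have ha : ∀ n, a n ∈ S := fun n => hab.subset n (Set.left_mem_Icc.2 (hab.le n))
  have hb : ∀ n, b n ∈ S := fun n => hab.subset n (Set.right_mem_Icc.2 (hab.le n))
  have hc : ∀ n, c n ∈ T := fun n => hcd.subset n (Set.left_mem_Icc.2 (hcd.le n))
  have hd : ∀ n, d n ∈ T := fun n => hcd.subset n (Set.right_mem_Icc.2 (hcd.le n))
  have conS : ∀ y ∈ T, ContinuousOn (fun s : ℝ => f (s + y * Complex.I)) S := fun y hy =>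
    hf.continuousOn.comp (by fun_prop) (fun s hs => by simp [Complex.mem_reProdIm, hs, hy])
  have conT : ∀ s ∈ S, ContinuousOn (fun y : ℝ => f (s + y * Complex.I)) T := fun s hs =>
    hf.continuousOn.comp (by fun_prop) (fun y hy => by simp [Complex.mem_reProdIm, hs, hy])
  obtain ⟨ib, tb⟩ := hab.tendsto_integral hS (fun n => conS _ (hc n)) hg
    (bg.mono fun s hs n => hs _ (hc n)) lb
  obtain ⟨it, tt⟩ := hab.tendsto_integral hS (fun n => conS _ (hd n)) hg
    (bg.mono fun s hs n => hs _ (hd n)) lt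
  obtain ⟨il, tl⟩ := hcd.tendsto_integral hT (fun n => conT _ (ha n)) hh
    (bh.mono fun s hs n => hs _ (ha n)) ll
  obtain ⟨ir, tr⟩ := hcd.tendsto_integral hT (fun n => conT _ (hb n)) hh
    (bh.mono fun s hs n => hs _ (hb n)) lr
  refine ⟨⟨ib, it, il, ir⟩, ?_⟩
  -- The same combination of integrals over the inner rectangle `[a n, b n] × [c n, d n]` vanishes
  -- for every `n`, so its limit is zero.
  refine tendsto_nhds_unique
    (((tb.sub tt).add (tr.const_mul Complex.I)).sub (tl.const_mul Complex.I)) ?_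
  refine tendsto_const_nhds.congr fun n => ?_
  have := Complex.integral_boundary_rect_eq_zero_of_differentiableOn f
    (a n + c n * Complex.I) (b n + d n * Complex.I) (hf.mono (by
      simp only [Complex.add_re, Complex.ofReal_re, Complex.mul_re, Complex.I_re, mul_zero,
        Complex.ofReal_im, Complex.I_im, mul_one, sub_self, add_zero, Complex.add_im,
        Complex.mul_im, zero_add]
      rw [Set.uIcc_of_le (hab.le n), Set.uIcc_of_le (hcd.le n)]
      exact fun z hz => ⟨hab.subset n hz.1, hcd.subset n hz.2⟩))
  simpa using this.symm

/-! ### Exhaustions of half-lines and bounded intervals -/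

theorem tendsto_add_inv_nat (q δ : ℝ) :
    Tendsto (fun n : ℕ => q + δ * ((n : ℝ) + 2)⁻¹) atTop (𝓝 q) := by
  have h : Tendsto (fun n : ℕ => ((n : ℝ) + 2)⁻¹) atTop (𝓝 0) :=
    tendsto_inv_atTop_zero.comp (tendsto_atTop_add_const_right _ _ tendsto_natCast_atTop_atTop)
  simpa using (h.const_mul δ).const_add q

theorem tendsto_add_inv_nat_right (q : ℝ) {δ : ℝ} (hδ : 0 < δ) :
    Tendsto (fun n : ℕ => q + δ * ((n : ℝ) + 2)⁻¹) atTop (𝓝[>] q) :=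
  tendsto_nhdsWithin_iff.2 ⟨tendsto_add_inv_nat q δ, Eventually.of_forall fun n => by
    simp only [Set.mem_Ioi]; have : 0 < δ * ((n : ℝ) + 2)⁻¹ := by positivity
    linarith⟩

theorem tendsto_add_inv_nat_left (q : ℝ) {δ : ℝ} (hδ : 0 < δ) :
    Tendsto (fun n : ℕ => q + -δ * ((n : ℝ) + 2)⁻¹) atTop (𝓝[<] q) :=
  tendsto_nhdsWithin_iff.2 ⟨tendsto_add_inv_nat q (-δ), Eventually.of_forall fun n => by
    simp only [Set.mem_Iio]; have : 0 < δ * ((n : ℝ) + 2)⁻¹ := by positivity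
    linarith⟩

theorem tendsto_add_nat_atTop (q : ℝ) :
    Tendsto (fun n : ℕ => q + ((n : ℝ) + 2)) atTop atTop :=
  tendsto_atTop_add_const_left _ _ (tendsto_atTop_add_const_right _ _ tendsto_natCast_atTop_atTop)

theorem tendsto_sub_nat_atBot (q : ℝ) :
    Tendsto (fun n : ℕ => q - ((n : ℝ) + 2)) atTop atBot := by
  simp_rw [sub_eq_add_neg]
  exact tendsto_atBot_add_const_left _ _ (tendsto_neg_atTop_atBot.comp
    (tendsto_atTop_add_const_right _ _ tendsto_natCast_atTop_atTop))

theorem exhausts_Ioi (q : ℝ) :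
    Exhausts (Set.Ioi q) (fun n => q + 1 * ((n : ℝ) + 2)⁻¹) (fun n => q + ((n : ℝ) + 2)) where
  le n := by
    have : ((n : ℝ) + 2)⁻¹ ≤ 1 := inv_le_one_of_one_le₀ (by linarith [n.cast_nonneg (α := ℝ)])
    linarith [n.cast_nonneg (α := ℝ)]
  subset n s hs := by
    have : 0 < ((n : ℝ) + 2)⁻¹ := by positivity
    exact lt_of_lt_of_le (by linarith) hs.1
  eventually_mem s hs :=
    ((tendsto_add_inv_nat q 1).eventually_lt_const hs).and
      ((tendsto_add_nat_atTop q).eventually_ge_atTop s)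

theorem exhausts_Iio (q : ℝ) :
    Exhausts (Set.Iio q) (fun n => q - ((n : ℝ) + 2)) (fun n => q + -1 * ((n : ℝ) + 2)⁻¹) where
  le n := by
    have : ((n : ℝ) + 2)⁻¹ ≤ 1 := inv_le_one_of_one_le₀ (by linarith [n.cast_nonneg (α := ℝ)])
    linarith [n.cast_nonneg (α := ℝ)]
  subset n s hs := by
    have : 0 < ((n : ℝ) + 2)⁻¹ := by positivity
    exact lt_of_le_of_lt hs.2 (by linarith)
  eventually_mem s hs :=
    ((tendsto_sub_nat_atBot q).eventually_lt_atBot s).and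
      (((tendsto_add_inv_nat q (-1)).eventually_const_lt hs).mono fun _ h => h.le)

theorem exhausts_Ioo {p q : ℝ} (h : p < q) :
    Exhausts (Set.Ioo p q) (fun n => p + (q - p) * ((n : ℝ) + 2)⁻¹)
      (fun n => q + -(q - p) * ((n : ℝ) + 2)⁻¹) where
  le n := by
    -- The shift by 2 keeps each endpoint within half the length of the interval, so the endpoints
    -- do not cross even at `n = 0`.
    have : ((n : ℝ) + 2)⁻¹ ≤ 2⁻¹ := inv_anti₀ (by norm_num) (by linarith [n.cast_nonneg (α := ℝ)])
    nlinarith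
  subset n s hs := by
    have : 0 < (q - p) * ((n : ℝ) + 2)⁻¹ := mul_pos (sub_pos.2 h) (by positivity)
    exact ⟨lt_of_lt_of_le (by linarith) hs.1, lt_of_le_of_lt hs.2 (by linarith)⟩
  eventually_mem s hs :=
    ((tendsto_add_inv_nat p (q - p)).eventually_lt_const hs.1).and
      (((tendsto_add_inv_nat q (-(q - p))).eventually_const_lt hs.2).mono fun _ h => h.le)

/-! ### Gluing the six cells of the plane cut along three lines -/

theorem integral_eq_add_Iio_Ioo_Ioi {F : ℝ → ℂ} {p q : ℝ} (h : p < q)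
    (h1 : IntegrableOn F (Set.Iio p)) (h2 : IntegrableOn F (Set.Ioo p q))
    (h3 : IntegrableOn F (Set.Ioi q)) :
    Integrable F ∧ ∫ s, F s = (∫ s in Set.Iio p, F s) + (∫ s in Set.Ioo p q, F s)
      + ∫ s in Set.Ioi q, F s := by
  have h1' : IntegrableOn F (Set.Iic p) := (integrableOn_Iic_iff_integrableOn_Iio (by simp)).2 h1
  have h2' : IntegrableOn F (Set.Ioc p q) := (integrableOn_Ioc_iff_integrableOn_Ioo (by simp)).2 h2
  have h4 : IntegrableOn F (Set.Iic q) := by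
    rw [← Set.Iic_union_Ioc_eq_Iic h.le]; exact h1'.union h2'
  have h5 : Integrable F := by
    rw [← integrableOn_univ, ← Set.Iic_union_Ioi (a := q)]; exact h4.union h3
  refine ⟨h5, ?_⟩
  rw [← integral_Iic_eq_integral_Iio, ← integral_Ioc_eq_integral_Ioo,
    ← setIntegral_union (Set.Iic_disjoint_Ioc le_rfl) measurableSet_Ioc h1' h2',
    Set.Iic_union_Ioc_eq_Iic h.le, ← setIntegral_union (Set.Iic_disjoint_Ioi le_rfl)
      measurableSet_Ioi h4 h3, Set.Iic_union_Ioi, setIntegral_univ]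

/-- Cauchy's theorem for the horizontal strip `ℝ × T`, cut along two vertical lines. -/
theorem integral_boundary_strip_eq_zero {T : Set ℝ} {c d : ℕ → ℝ} {p q : ℝ} (hpq : p < q)
    (hcd : Exhausts T c d) (hT : MeasurableSet T)
    {f : ℂ → ℂ} (hf : DifferentiableOn ℂ f {z | z.re ≠ p ∧ z.re ≠ q ∧ z.im ∈ T}) {g h : ℝ → ℝ}
    (hg : Integrable g) (hh : IntegrableOn h T)
    (bg : ∀ᵐ s : ℝ, ∀ y ∈ T, ‖f (s + y * Complex.I)‖ ≤ g s)
    (bh : ∀ᵐ (y : ℝ) ∂volume.restrict T, ∀ s : ℝ, s ≠ p → s ≠ q → ‖f (s + y * Complex.I)‖ ≤ h y)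
    {fb ft lp rp lq rq : ℝ → ℂ}
    (lb : ∀ᵐ s : ℝ, Tendsto (fun n => f (s + c n * Complex.I)) atTop (𝓝 (fb s)))
    (lt : ∀ᵐ s : ℝ, Tendsto (fun n => f (s + d n * Complex.I)) atTop (𝓝 (ft s)))
    (hlp : ∀ᵐ (y : ℝ) ∂volume.restrict T,
      Tendsto (fun s : ℝ => f (s + y * Complex.I)) (𝓝[<] p) (𝓝 (lp y)))
    (hrp : ∀ᵐ (y : ℝ) ∂volume.restrict T,
      Tendsto (fun s : ℝ => f (s + y * Complex.I)) (𝓝[>] p) (𝓝 (rp y)))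
    (hlq : ∀ᵐ (y : ℝ) ∂volume.restrict T,
      Tendsto (fun s : ℝ => f (s + y * Complex.I)) (𝓝[<] q) (𝓝 (lq y)))
    (hrq : ∀ᵐ (y : ℝ) ∂volume.restrict T,
      Tendsto (fun s : ℝ => f (s + y * Complex.I)) (𝓝[>] q) (𝓝 (rq y)))
    (hbot : ∀ᵐ (y : ℝ) ∂volume.restrict T,
      Tendsto (fun s : ℝ => f (s + y * Complex.I)) atBot (𝓝 0))
    (htop : ∀ᵐ (y : ℝ) ∂volume.restrict T,
      Tendsto (fun s : ℝ => f (s + y * Complex.I)) atTop (𝓝 0)) :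
    (Integrable fb ∧ Integrable ft ∧ IntegrableOn lp T ∧ IntegrableOn rp T ∧
      IntegrableOn lq T ∧ IntegrableOn rq T) ∧
    (∫ s, fb s) - (∫ s, ft s) + Complex.I * ((∫ y in T, lp y) - ∫ y in T, rp y)
      + Complex.I * ((∫ y in T, lq y) - ∫ y in T, rq y) = 0 := by
  obtain ⟨⟨b1, t1, -, i1⟩, e1⟩ := integral_boundary_rect_eq_zero (exhausts_Iio p) hcd
    measurableSet_Iio hT (hf.mono fun z hz => ⟨ne_of_lt hz.1, ne_of_lt (lt_trans hz.1 hpq), hz.2⟩)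
    hg.integrableOn hh (ae_restrict_of_ae bg)
    (bh.mono fun y hy s hs => hy s (ne_of_lt hs) (ne_of_lt (lt_trans hs hpq)))
    (ae_restrict_of_ae lb) (ae_restrict_of_ae lt)
    (hbot.mono fun y hy => hy.comp (tendsto_sub_nat_atBot p))
    (hlp.mono fun y hy => hy.comp (tendsto_add_inv_nat_left p one_pos))
  obtain ⟨⟨b2, t2, i2, i3⟩, e2⟩ := integral_boundary_rect_eq_zero (exhausts_Ioo hpq) hcd
    measurableSet_Ioo hT (hf.mono fun z hz => ⟨ne_of_gt hz.1.1, ne_of_lt hz.1.2, hz.2⟩)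
    hg.integrableOn hh (ae_restrict_of_ae bg)
    (bh.mono fun y hy s hs => hy s (ne_of_gt hs.1) (ne_of_lt hs.2))
    (ae_restrict_of_ae lb) (ae_restrict_of_ae lt)
    (hrp.mono fun y hy => hy.comp (tendsto_add_inv_nat_right p (sub_pos.2 hpq)))
    (hlq.mono fun y hy => hy.comp (tendsto_add_inv_nat_left q (sub_pos.2 hpq)))
  obtain ⟨⟨b3, t3, i4, -⟩, e3⟩ := integral_boundary_rect_eq_zero (exhausts_Ioi q) hcd
    measurableSet_Ioi hT (hf.mono fun z hz => ⟨ne_of_gt (lt_trans hpq hz.1), ne_of_gt hz.1, hz.2⟩)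
    hg.integrableOn hh (ae_restrict_of_ae bg)
    (bh.mono fun y hy s hs => hy s (ne_of_gt (lt_trans hpq hs)) (ne_of_gt hs))
    (ae_restrict_of_ae lb) (ae_restrict_of_ae lt)
    (hrq.mono fun y hy => hy.comp (tendsto_add_inv_nat_right q one_pos))
    (htop.mono fun y hy => hy.comp (tendsto_add_nat_atTop q))
  obtain ⟨b4, eb⟩ := integral_eq_add_Iio_Ioo_Ioi hpq b1 b2 b3
  obtain ⟨t4, et⟩ := integral_eq_add_Iio_Ioo_Ioi hpq t1 t2 t3
  refine ⟨⟨b4, t4, i1, i2, i3, i4⟩, ?_⟩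
  rw [eb, et]
  simp only [integral_zero, mul_zero] at e1 e3
  linear_combination e1 + e2 + e3

theorem integral_eq_add_Iio_Ioi {F : ℝ → ℂ}
    (h1 : IntegrableOn F (Set.Iio 0)) (h2 : IntegrableOn F (Set.Ioi 0)) :
    Integrable F ∧ ∫ s, F s = (∫ s in Set.Iio 0, F s) + ∫ s in Set.Ioi 0, F s := by
  have h1' : IntegrableOn F (Set.Iic 0) := (integrableOn_Iic_iff_integrableOn_Iio (by simp)).2 h1
  have h5 : Integrable F := by
    rw [← integrableOn_univ, ← Set.Iic_union_Ioi (a := (0 : ℝ))]; exact h1'.union h2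
  refine ⟨h5, ?_⟩
  rw [← integral_Iic_eq_integral_Iio, ← setIntegral_union (Set.Iic_disjoint_Ioi le_rfl)
      measurableSet_Ioi h1' h2, Set.Iic_union_Ioi, setIntegral_univ]

/-- Cauchy's theorem for the plane cut along the real line and two vertical lines: the jumps of
a dominated holomorphic function have total integral zero. -/
theorem integral_jump_eq_zero_of_lt {p q : ℝ} (hpq : p < q)
    {f : ℂ → ℂ} (hf : DifferentiableOn ℂ f {z | z.re ≠ p ∧ z.re ≠ q ∧ z.im ≠ 0}) {g h : ℝ → ℝ}
    (hg : Integrable g) (hh : Integrable h)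
    (bg : ∀ᵐ s : ℝ, ∀ y : ℝ, y ≠ 0 → ‖f (s + y * Complex.I)‖ ≤ g s)
    (bh : ∀ᵐ y : ℝ, ∀ s : ℝ, s ≠ p → s ≠ q → ‖f (s + y * Complex.I)‖ ≤ h y)
    {U L lp rp lq rq : ℝ → ℂ}
    (hU : ∀ᵐ s : ℝ, Tendsto (fun y : ℝ => f (s + y * Complex.I)) (𝓝[>] 0) (𝓝 (U s)))
    (hL : ∀ᵐ s : ℝ, Tendsto (fun y : ℝ => f (s + y * Complex.I)) (𝓝[<] 0) (𝓝 (L s)))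
    (hUtop : ∀ᵐ s : ℝ, Tendsto (fun y : ℝ => f (s + y * Complex.I)) atTop (𝓝 0))
    (hLbot : ∀ᵐ s : ℝ, Tendsto (fun y : ℝ => f (s + y * Complex.I)) atBot (𝓝 0))
    (hlp : ∀ᵐ y : ℝ, Tendsto (fun s : ℝ => f (s + y * Complex.I)) (𝓝[<] p) (𝓝 (lp y)))
    (hrp : ∀ᵐ y : ℝ, Tendsto (fun s : ℝ => f (s + y * Complex.I)) (𝓝[>] p) (𝓝 (rp y)))
    (hlq : ∀ᵐ y : ℝ, Tendsto (fun s : ℝ => f (s + y * Complex.I)) (𝓝[<] q) (𝓝 (lq y)))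
    (hrq : ∀ᵐ y : ℝ, Tendsto (fun s : ℝ => f (s + y * Complex.I)) (𝓝[>] q) (𝓝 (rq y)))
    (hbot : ∀ᵐ y : ℝ, Tendsto (fun s : ℝ => f (s + y * Complex.I)) atBot (𝓝 0))
    (htop : ∀ᵐ y : ℝ, Tendsto (fun s : ℝ => f (s + y * Complex.I)) atTop (𝓝 0)) :
    (Integrable U ∧ Integrable L ∧ Integrable lp ∧ Integrable rp ∧ Integrable lq ∧
      Integrable rq) ∧
    (∫ s, U s - L s) + Complex.I * (∫ y, lp y - rp y) + Complex.I * (∫ y, lq y - rq y) = 0 := by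
  -- In the upper half plane the top side recedes to infinity and its limit function is zero; in the
  -- lower half plane this happens to the bottom side.
  obtain ⟨⟨u, -, a1, a2, a3, a4⟩, e1⟩ := integral_boundary_strip_eq_zero hpq (exhausts_Ioi 0)
    measurableSet_Ioi (hf.mono fun z hz => ⟨hz.1, hz.2.1, ne_of_gt hz.2.2⟩) hg hh.integrableOn
    (bg.mono fun s hs y hy => hs y (ne_of_gt hy)) (ae_restrict_of_ae bh)
    (hU.mono fun s hs => hs.comp (tendsto_add_inv_nat_right 0 one_pos))
    (hUtop.mono fun s hs => hs.comp (tendsto_add_nat_atTop 0))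
    (ae_restrict_of_ae hlp) (ae_restrict_of_ae hrp) (ae_restrict_of_ae hlq)
    (ae_restrict_of_ae hrq) (ae_restrict_of_ae hbot) (ae_restrict_of_ae htop)
  obtain ⟨⟨-, l, b1, b2, b3, b4⟩, e2⟩ := integral_boundary_strip_eq_zero hpq (exhausts_Iio 0)
    measurableSet_Iio (hf.mono fun z hz => ⟨hz.1, hz.2.1, ne_of_lt hz.2.2⟩) hg hh.integrableOn
    (bg.mono fun s hs y hy => hs y (ne_of_lt hy)) (ae_restrict_of_ae bh)
    (hLbot.mono fun s hs => hs.comp (tendsto_sub_nat_atBot 0))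
    (hL.mono fun s hs => hs.comp (tendsto_add_inv_nat_left 0 one_pos))
    (ae_restrict_of_ae hlp) (ae_restrict_of_ae hrp) (ae_restrict_of_ae hlq)
    (ae_restrict_of_ae hrq) (ae_restrict_of_ae hbot) (ae_restrict_of_ae htop)
  obtain ⟨i1, f1⟩ := integral_eq_add_Iio_Ioi b1 a1
  obtain ⟨i2, f2⟩ := integral_eq_add_Iio_Ioi b2 a2
  obtain ⟨i3, f3⟩ := integral_eq_add_Iio_Ioi b3 a3
  obtain ⟨i4, f4⟩ := integral_eq_add_Iio_Ioi b4 a4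
  refine ⟨⟨u, l, i1, i2, i3, i4⟩, ?_⟩
  rw [integral_sub u l, integral_sub i1 i2, integral_sub i3 i4, f1, f2, f3, f4]
  simp only [integral_zero] at e1 e2
  linear_combination e1 + e2

/-- The two vertical lines play symmetric roles, so their order is immaterial. This matters because
the sign of `V` is not prescribed. -/
theorem integral_jump_eq_zero {p q : ℝ} (hpq : p ≠ q)
    {f : ℂ → ℂ} (hf : DifferentiableOn ℂ f {z | z.re ≠ p ∧ z.re ≠ q ∧ z.im ≠ 0}) {g h : ℝ → ℝ}
    (hg : Integrable g) (hh : Integrable h)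
    (bg : ∀ᵐ s : ℝ, ∀ y : ℝ, y ≠ 0 → ‖f (s + y * Complex.I)‖ ≤ g s)
    (bh : ∀ᵐ y : ℝ, ∀ s : ℝ, s ≠ p → s ≠ q → ‖f (s + y * Complex.I)‖ ≤ h y)
    {U L lp rp lq rq : ℝ → ℂ}
    (hU : ∀ᵐ s : ℝ, Tendsto (fun y : ℝ => f (s + y * Complex.I)) (𝓝[>] 0) (𝓝 (U s)))
    (hL : ∀ᵐ s : ℝ, Tendsto (fun y : ℝ => f (s + y * Complex.I)) (𝓝[<] 0) (𝓝 (L s)))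
    (hUtop : ∀ᵐ s : ℝ, Tendsto (fun y : ℝ => f (s + y * Complex.I)) atTop (𝓝 0))
    (hLbot : ∀ᵐ s : ℝ, Tendsto (fun y : ℝ => f (s + y * Complex.I)) atBot (𝓝 0))
    (hlp : ∀ᵐ y : ℝ, Tendsto (fun s : ℝ => f (s + y * Complex.I)) (𝓝[<] p) (𝓝 (lp y)))
    (hrp : ∀ᵐ y : ℝ, Tendsto (fun s : ℝ => f (s + y * Complex.I)) (𝓝[>] p) (𝓝 (rp y)))
    (hlq : ∀ᵐ y : ℝ, Tendsto (fun s : ℝ => f (s + y * Complex.I)) (𝓝[<] q) (𝓝 (lq y)))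
    (hrq : ∀ᵐ y : ℝ, Tendsto (fun s : ℝ => f (s + y * Complex.I)) (𝓝[>] q) (𝓝 (rq y)))
    (hbot : ∀ᵐ y : ℝ, Tendsto (fun s : ℝ => f (s + y * Complex.I)) atBot (𝓝 0))
    (htop : ∀ᵐ y : ℝ, Tendsto (fun s : ℝ => f (s + y * Complex.I)) atTop (𝓝 0)) :
    (Integrable U ∧ Integrable L ∧ Integrable lp ∧ Integrable rp ∧ Integrable lq ∧
      Integrable rq) ∧
    (∫ s, U s - L s) + Complex.I * (∫ y, lp y - rp y) + Complex.I * (∫ y, lq y - rq y) = 0 := by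
  rcases lt_or_gt_of_ne hpq with h' | h'
  · exact integral_jump_eq_zero_of_lt h' hf hg hh bg bh hU hL hUtop hLbot hlp hrp hlq hrq hbot htop
  · obtain ⟨⟨a1, a2, a3, a4, a5, a6⟩, e⟩ := integral_jump_eq_zero_of_lt h'
      (hf.mono fun z hz => ⟨hz.2.1, hz.1, hz.2.2⟩) hg hh bg
      (bh.mono fun y hy s h1 h2 => hy s h2 h1) hU hL hUtop hLbot hlq hrq hlp hrp hbot htop
    exact ⟨⟨a1, a2, a5, a6, a3, a4⟩, by linear_combination e⟩

/-! ### Integrable majorants -/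

theorem integrableOn_abs_rpow {r : ℝ} (hr : -1 < r) :
    IntegrableOn (fun s : ℝ => |s| ^ r) (Set.Icc (-1) 1) := by
  have h : ∀ b : ℝ, 0 ≤ b → IntervalIntegrable (fun s : ℝ => |s| ^ r) volume 0 b := fun b hb => by
    refine (intervalIntegral.intervalIntegrable_rpow' (a := 0) (b := b) hr).congr ?_
    intro s hs
    rw [Set.uIoc_of_le hb] at hs
    simp only [abs_of_pos hs.1]
  have h1 := h 1 zero_le_one
  have h2 : IntervalIntegrable (fun s : ℝ => |s| ^ r) volume (-1) 0 := by
    have := (h1.comp_sub_left 0)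
    simp only [zero_sub, abs_neg, neg_zero] at this
    simpa using this.symm
  rw [integrableOn_Icc_iff_integrableOn_Ioc,
    ← intervalIntegrable_iff_integrableOn_Ioc_of_le (by norm_num)]
  exact h2.trans h1

/-- Within distance 1 of `q` the second factor is at most 1 and the power is integrable; farther
away the power is at most 1 and the second factor is integrable. The sum of these two majorants
works everywhere. -/
theorem integrable_rpow_mul_inv_one_add_sq {r : ℝ} (hr : -1 < r) (hr' : r ≤ 0) (q : ℝ) :
    Integrable (fun s : ℝ => |s - q| ^ r * (1 + s ^ 2)⁻¹) := by
  have h1 : Integrable (fun s : ℝ => (Set.Icc (-1 : ℝ) 1).indicator (fun s => |s| ^ r) (s - q)) :=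
    ((integrable_indicator_iff measurableSet_Icc).2 (integrableOn_abs_rpow hr)).comp_sub_right q
  have h2 := h1.add integrable_inv_one_add_sq
  have hm : Measurable (fun s : ℝ => |s - q| ^ r * (1 + s ^ 2)⁻¹) := by fun_prop
  refine h2.mono' hm.aestronglyMeasurable (Eventually.of_forall fun s => ?_)
  have h3 : 0 ≤ |s - q| ^ r := by positivity
  have h4 : 0 < (1 + s ^ 2)⁻¹ := by positivity
  have h5 : (1 + s ^ 2)⁻¹ ≤ 1 := inv_le_one_of_one_le₀ (by nlinarith)
  rw [Real.norm_of_nonneg (by positivity)]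
  simp only [Pi.add_apply]
  by_cases hs : s - q ∈ Set.Icc (-1 : ℝ) 1
  · rw [Set.indicator_of_mem hs]
    nlinarith
  · rw [Set.indicator_of_notMem hs]
    have : 1 ≤ |s - q| := by
      by_contra hlt
      exact hs (abs_le.1 (not_le.1 hlt).le)
    have := Real.rpow_le_one_of_one_le_of_nonpos this hr'
    nlinarith

theorem tendsto_inv_one_add_sq_atTop : Tendsto (fun s : ℝ => (1 + s ^ 2)⁻¹) atTop (𝓝 0) :=
  tendsto_inv_atTop_zero.comp (tendsto_atTop_add_const_left _ _ (tendsto_pow_atTop two_ne_zero))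

theorem tendsto_inv_one_add_sq_atBot : Tendsto (fun s : ℝ => (1 + s ^ 2)⁻¹) atBot (𝓝 0) := by
  simpa [Function.comp_def] using tendsto_inv_one_add_sq_atTop.comp tendsto_neg_atBot_atTop

/-! ### The contour, its boundary values and the vanishing of the total jump -/

namespace Data

variable (D : Data)

/-- The growth allowed at the branch points. -/
def weight (z : ℂ) : ℝ :=
  1 + ‖z - D.pPlus‖ ^ (-(1 / 4) : ℝ) + ‖z - conj D.pPlus‖ ^ (-(1 / 4) : ℝ)

/-- `fp` and `fm` are the boundary values of `f` from the left and from the right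
of the contour. -/
structure HasBoundaryValues (f fp fm : ℂ → ℂ) : Prop where
  left_real : ∀ k ∈ D.realPart, Tendsto f (𝓝[{w | 0 < w.im}] k) (𝓝 (fp k))
  right_real : ∀ k ∈ D.realPart, Tendsto f (𝓝[{w | w.im < 0}] k) (𝓝 (fm k))
  left_cuts : ∀ k ∈ D.cuts, Tendsto f (𝓝[{w | w.re < k.re}] k) (𝓝 (fp k))
  right_cuts : ∀ k ∈ D.cuts, Tendsto f (𝓝[{w | k.re < w.re}] k) (𝓝 (fm k))

theorem one_le_weight (z : ℂ) : 1 ≤ D.weight z := by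
  unfold weight
  have h1 : 0 ≤ ‖z - D.pPlus‖ ^ (-(1 / 4) : ℝ) := by positivity
  have h2 : 0 ≤ ‖z - conj D.pPlus‖ ^ (-(1 / 4) : ℝ) := by positivity
  linarith

theorem weight_pos (z : ℂ) : 0 < D.weight z := one_pos.trans_le (D.one_le_weight z)

@[simp] theorem pPlus_re : D.pPlus.re = -(D.V / 2) := by
  simp [pPlus, Complex.div_ofNat_re]

@[simp] theorem pPlus_im : D.pPlus.im = D.Ap := by
  simp [pPlus, Complex.div_ofNat_im]

@[simp] theorem pMinus_re : D.pMinus.re = D.V / 2 := by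
  simp [pMinus, Complex.div_ofNat_re]

@[simp] theorem pMinus_im : D.pMinus.im = D.Am := by
  simp [pMinus, Complex.div_ofNat_im]

/-- Both branch points of `Σ₊` lie at horizontal distance `|s + V/2|`. The bound does not depend on
`y`, as domination along moving horizontal lines requires; `weight_le_im` is the counterpart for
vertical lines. -/
theorem weight_le_re {s : ℝ} (hs : s ≠ -(D.V / 2)) (y : ℝ) :
    D.weight (s + y * Complex.I) ≤ 1 + 2 * |s - -(D.V / 2)| ^ (-(1 / 4) : ℝ) := by
  have h0 : 0 < |s - -(D.V / 2)| := abs_pos.2 (sub_ne_zero.2 hs)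
  have h1 : |s - -(D.V / 2)| ≤ ‖(s + y * Complex.I : ℂ) - D.pPlus‖ := by
    simpa using Complex.abs_re_le_norm ((s + y * Complex.I : ℂ) - D.pPlus)
  have h2 : |s - -(D.V / 2)| ≤ ‖(s + y * Complex.I : ℂ) - conj D.pPlus‖ := by
    simpa using Complex.abs_re_le_norm ((s + y * Complex.I : ℂ) - conj D.pPlus)
  have h3 := Real.rpow_le_rpow_of_nonpos h0 h1 (z := -(1 / 4)) (by norm_num)
  have h4 := Real.rpow_le_rpow_of_nonpos h0 h2 (z := -(1 / 4)) (by norm_num)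
  unfold weight
  linarith

theorem weight_le_im {y : ℝ} (h1 : y ≠ D.Ap) (h2 : y ≠ -D.Ap) (s : ℝ) :
    D.weight (s + y * Complex.I) ≤
      1 + |y - D.Ap| ^ (-(1 / 4) : ℝ) + |y - -D.Ap| ^ (-(1 / 4) : ℝ) := by
  have h3 : |y - D.Ap| ≤ ‖(s + y * Complex.I : ℂ) - D.pPlus‖ := by
    simpa using Complex.abs_im_le_norm ((s + y * Complex.I : ℂ) - D.pPlus)
  have h4 : |y - -D.Ap| ≤ ‖(s + y * Complex.I : ℂ) - conj D.pPlus‖ := by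
    simpa using Complex.abs_im_le_norm ((s + y * Complex.I : ℂ) - conj D.pPlus)
  have h5 := Real.rpow_le_rpow_of_nonpos (abs_pos.2 (sub_ne_zero.2 h1)) h3 (z := -(1 / 4))
    (by norm_num)
  have h6 := Real.rpow_le_rpow_of_nonpos (abs_pos.2 (sub_ne_zero.2 h2)) h4 (z := -(1 / 4))
    (by norm_num)
  unfold weight
  linarith

theorem sq_re_le (s y : ℝ) : 1 + s ^ 2 ≤ (1 + ‖(s + y * Complex.I : ℂ)‖) ^ 2 := by
  have h : |s| ≤ ‖(s + y * Complex.I : ℂ)‖ := by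
    simpa using Complex.abs_re_le_norm (s + y * Complex.I : ℂ)
  nlinarith [sq_abs s, abs_nonneg s]

theorem sq_im_le (s y : ℝ) : 1 + y ^ 2 ≤ (1 + ‖(s + y * Complex.I : ℂ)‖) ^ 2 := by
  have h : |y| ≤ ‖(s + y * Complex.I : ℂ)‖ := by
    simpa using Complex.abs_im_le_norm (s + y * Complex.I : ℂ)
  nlinarith [sq_abs y, abs_nonneg y]

theorem notMem_sigma_iff {z : ℂ} : z ∉ D.sigma ↔
    z.im ≠ 0 ∧ (z.re = -(D.V / 2) → D.Ap < |z.im|) ∧ (z.re = D.V / 2 → D.Am < |z.im|) := by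
  simp [sigma, sigmaPlus, sigmaMinus, not_or, and_assoc]

theorem isClosed_sigma : IsClosed D.sigma := by
  refine IsClosed.union (IsClosed.union ?_ ?_) ?_
  · exact isClosed_eq Complex.continuous_im continuous_const
  · exact (isClosed_eq Complex.continuous_re continuous_const).inter
      (isClosed_le Complex.continuous_im.abs continuous_const)
  · exact (isClosed_eq Complex.continuous_re continuous_const).inter
      (isClosed_le Complex.continuous_im.abs continuous_const)

theorem mem_cuts_plus (s : ℝ) (h0 : s ≠ 0) (h : |s| < D.Ap) :
    -(D.V / 2 : ℂ) + Complex.I * s ∈ D.cuts := by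
  have h' := abs_lt.1 h
  rcases lt_or_gt_of_ne h0 with h1 | h1
  · exact Or.inl (Or.inl (Or.inr (by simpa [sigmaPlus2, Complex.div_ofNat_re] using ⟨h'.1, h1⟩)))
  · exact Or.inl (Or.inl (Or.inl (by simpa [sigmaPlus1, Complex.div_ofNat_re] using ⟨h1, h'.2⟩)))

theorem mem_cuts_minus (s : ℝ) (h0 : s ≠ 0) (h : |s| < D.Am) :
    (D.V / 2 : ℂ) + Complex.I * s ∈ D.cuts := by
  have h' := abs_lt.1 h
  rcases lt_or_gt_of_ne h0 with h1 | h1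
  · exact Or.inr (by simpa [sigmaMinus2, Complex.div_ofNat_re] using ⟨h'.1, h1⟩)
  · exact Or.inl (Or.inr (by simpa [sigmaMinus1, Complex.div_ofNat_re] using ⟨h1, h'.2⟩))

variable {D}

/-- The cells are bounded by full vertical lines, of which only a segment belongs to the contour. On
the rest of the line `f` is continuous and its own value is the one-sided limit. -/
theorem HasBoundaryValues.tendsto_left {f fp fm : ℂ → ℂ} (hb : D.HasBoundaryValues f fp fm)
    (hf : ContinuousOn f D.sigmaᶜ) {q : ℂ} {A y : ℝ}
    (hin : |y| < A → q + Complex.I * y ∈ D.cuts) (hq : q.im = 0)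
    (hout : ¬ |y| < A → q + Complex.I * y ∉ D.sigma) :
    Tendsto (fun s : ℝ => f (s + y * Complex.I)) (𝓝[<] q.re)
      (𝓝 (if |y| < A then fp (q + Complex.I * y) else f (q + Complex.I * y))) := by
  have hz : q + Complex.I * y = (q.re : ℂ) + y * Complex.I := by
    apply Complex.ext <;> simp [hq]
  have hc : Tendsto (fun s : ℝ => (s + y * Complex.I : ℂ)) (𝓝[<] q.re)
      (𝓝 (q + Complex.I * y)) := by
    rw [hz]
    exact ((by fun_prop : Continuous fun s : ℝ => (s + y * Complex.I : ℂ)).tendsto _).mono_left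
      nhdsWithin_le_nhds
  split_ifs with h
  · refine (hb.left_cuts _ (hin h)).comp (tendsto_nhdsWithin_iff.2 ⟨hc, ?_⟩)
    filter_upwards [self_mem_nhdsWithin] with s hs
    simpa using hs
  · exact (hf.continuousAt (D.isClosed_sigma.isOpen_compl.mem_nhds (hout h))).tendsto.comp hc

theorem HasBoundaryValues.tendsto_right {f fp fm : ℂ → ℂ} (hb : D.HasBoundaryValues f fp fm)
    (hf : ContinuousOn f D.sigmaᶜ) {q : ℂ} {A y : ℝ}
    (hin : |y| < A → q + Complex.I * y ∈ D.cuts) (hq : q.im = 0)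
    (hout : ¬ |y| < A → q + Complex.I * y ∉ D.sigma) :
    Tendsto (fun s : ℝ => f (s + y * Complex.I)) (𝓝[>] q.re)
      (𝓝 (if |y| < A then fm (q + Complex.I * y) else f (q + Complex.I * y))) := by
  have hz : q + Complex.I * y = (q.re : ℂ) + y * Complex.I := by
    apply Complex.ext <;> simp [hq]
  have hc : Tendsto (fun s : ℝ => (s + y * Complex.I : ℂ)) (𝓝[>] q.re)
      (𝓝 (q + Complex.I * y)) := by
    rw [hz]
    exact ((by fun_prop : Continuous fun s : ℝ => (s + y * Complex.I : ℂ)).tendsto _).mono_left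
      nhdsWithin_le_nhds
  split_ifs with h
  · refine (hb.right_cuts _ (hin h)).comp (tendsto_nhdsWithin_iff.2 ⟨hc, ?_⟩)
    filter_upwards [self_mem_nhdsWithin] with s hs
    simpa using hs
  · exact (hf.continuousAt (D.isClosed_sigma.isOpen_compl.mem_nhds (hout h))).tendsto.comp hc

/-- Beyond the cut the limits from the two sides agree, so the full line contributes only the jump
across the segment. -/
theorem integral_ite_sub_ite {F G H : ℝ → ℂ} {A : ℝ} (hA : 0 ≤ A)
    (h1 : Integrable fun y => if |y| < A then F y else H y)
    (h2 : Integrable fun y => if |y| < A then G y else H y) :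
    IntervalIntegrable (fun y => F y - G y) volume (-A) A ∧
      (∫ y, (if |y| < A then F y else H y) - (if |y| < A then G y else H y)) =
        ∫ y in (-A)..A, F y - G y := by
  have e : (fun y => (if |y| < A then F y else H y) - (if |y| < A then G y else H y))
      = (Set.Ioo (-A) A).indicator fun y => F y - G y := by
    funext y
    by_cases h : |y| < A
    · rw [Set.indicator_of_mem (show y ∈ Set.Ioo (-A) A from abs_lt.1 h)]; simp [h]
    · rw [Set.indicator_of_notMem (show y ∉ Set.Ioo (-A) A from fun h' => h (abs_lt.2 h'))]
      simp [h]
  have hi := h1.sub h2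
  have hi' : Integrable ((Set.Ioo (-A) A).indicator fun y => F y - G y) := e ▸ hi
  rw [integrable_indicator_iff measurableSet_Ioo] at hi'
  refine ⟨?_, ?_⟩
  · rw [intervalIntegrable_iff_integrableOn_Ioc_of_le (by linarith)]
    exact (integrableOn_Ioc_iff_integrableOn_Ioo (by simp)).2 hi'
  · rw [e, integral_indicator measurableSet_Ioo, intervalIntegral.integral_of_le (by linarith),
      integral_Ioc_eq_integral_Ioo]

theorem ae_ne (a : ℝ) : ∀ᵐ s : ℝ, s ≠ a := by
  simp [ae_iff]

theorem notMem_sigma_of_ne {s y : ℝ} (h1 : s ≠ -(D.V / 2)) (h2 : s ≠ D.V / 2) (h3 : y ≠ 0) :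
    (s + y * Complex.I : ℂ) ∉ D.sigma := by
  rw [notMem_sigma_iff]; simp [h1, h2, h3]

/-- The jumps of a function which is holomorphic off the contour and decays like `k⁻²`
have total integral zero. -/
theorem contourIntegral_jump_eq_zero (hV : D.V ≠ 0) (hp : 0 < D.Ap) (hm : 0 < D.Am)
    {f fp fm : ℂ → ℂ} (hf : DifferentiableOn ℂ f D.sigmaᶜ) (hb : D.HasBoundaryValues f fp fm)
    {C : ℝ} (hC0 : 0 ≤ C) (hC : ∀ z ∉ D.sigma, ‖f z‖ ≤ C * D.weight z / (1 + ‖z‖) ^ 2) :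
    D.ContourIntegrable (fun ξ => fp ξ - fm ξ) ∧ D.contourIntegral (fun ξ => fp ξ - fm ξ) = 0 := by
  set p : ℝ := -(D.V / 2) with hpdef
  set q : ℝ := D.V / 2 with hqdef
  have hpq : p ≠ q := fun h => hV (by simp only [hpdef, hqdef] at h; linarith)
  -- The weight is bounded through the real part alone (`gs`) or the imaginary part alone (`hy`).
  -- The factor `(1 + ‖z‖)²` dominates both `1 + s²` and `1 + y²`: one choice yields an integrable
  -- majorant, the other the decay along the line.
  set gs : ℝ → ℝ := fun s => C * (1 + 2 * |s - p| ^ (-(1 / 4) : ℝ)) with hgs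
  set hy : ℝ → ℝ := fun y =>
    C * (1 + |y - D.Ap| ^ (-(1 / 4) : ℝ) + |y - -D.Ap| ^ (-(1 / 4) : ℝ)) with hhy
  have gs0 : ∀ s, 0 ≤ gs s := fun s => by simp only [hgs]; positivity
  have hy0 : ∀ s, 0 ≤ hy s := fun s => by simp only [hhy]; positivity
  have bound_gs : ∀ s y : ℝ, s ≠ p → s ≠ q → y ≠ 0 → ‖f (s + y * Complex.I)‖ ≤
      gs s / (1 + ‖(s + y * Complex.I : ℂ)‖) ^ 2 := fun s y h1 h2 h3 => by
    refine (hC _ (notMem_sigma_of_ne h1 h2 h3)).trans ?_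
    have := D.weight_le_re h1 y
    gcongr
    exact mul_le_mul_of_nonneg_left this hC0
  have bound_hy : ∀ s y : ℝ, s ≠ p → s ≠ q → y ≠ 0 → y ≠ D.Ap → y ≠ -D.Ap →
      ‖f (s + y * Complex.I)‖ ≤ hy y / (1 + ‖(s + y * Complex.I : ℂ)‖) ^ 2 :=
    fun s y h1 h2 h3 h4 h5 => by
    refine (hC _ (notMem_sigma_of_ne h1 h2 h3)).trans ?_
    have := D.weight_le_im h4 h5 s
    gcongr
    exact mul_le_mul_of_nonneg_left this hC0
  have ir := fun q => integrable_rpow_mul_inv_one_add_sq (r := -(1 / 4)) (by norm_num)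
    (by norm_num) q
  have hg : Integrable fun s => gs s * (1 + s ^ 2)⁻¹ := by
    have := (integrable_inv_one_add_sq.add ((ir p).const_mul 2)).const_mul C
    refine this.congr (Eventually.of_forall fun s => ?_)
    simp only [hgs, Pi.add_apply]; ring
  have hh : Integrable fun s => hy s * (1 + s ^ 2)⁻¹ := by
    have := ((integrable_inv_one_add_sq.add (ir D.Ap)).add (ir (-D.Ap))).const_mul C
    refine this.congr (Eventually.of_forall fun s => ?_)
    simp only [hhy, Pi.add_apply]; ring
  have hne_p : ∀ᵐ s : ℝ, s ≠ p := ae_ne p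
  have hne_q : ∀ᵐ s : ℝ, s ≠ q := ae_ne q
  have hne_0 : ∀ᵐ s : ℝ, s ≠ 0 := ae_ne 0
  have hne_A : ∀ᵐ s : ℝ, s ≠ D.Ap := ae_ne _
  have hne_A' : ∀ᵐ s : ℝ, s ≠ -D.Ap := ae_ne _
  have hne_B : ∀ᵐ s : ℝ, s ≠ D.Am := ae_ne _
  have hne_B' : ∀ᵐ s : ℝ, s ≠ -D.Am := ae_ne _
  have abs_ne : ∀ {y A : ℝ}, y ≠ A → y ≠ -A → ¬ |y| < A → A < |y| := fun {y A} h1 h2 h3 =>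
    lt_of_le_of_ne (not_lt.1 h3) fun h => by
      rcases abs_cases y with ⟨h', -⟩ | ⟨h', -⟩
      · exact h1 (by linarith)
      · exact h2 (by linarith)
  have pim : (-(D.V / 2 : ℂ)).im = 0 := by simp [Complex.div_ofNat_im]
  have qim : (D.V / 2 : ℂ).im = 0 := by simp [Complex.div_ofNat_im]
  have pre : (-(D.V / 2 : ℂ)).re = p := by simp [Complex.div_ofNat_re, hpdef]; rfl
  have qre : (D.V / 2 : ℂ).re = q := by simp [Complex.div_ofNat_re]; rfl
  have outp : ∀ y : ℝ, y ≠ 0 → D.Ap < |y| → -(D.V / 2 : ℂ) + Complex.I * y ∉ D.sigma :=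
    fun y h0 h => by
    rw [notMem_sigma_iff]
    simp only [Complex.add_re, Complex.add_im, pim, pre]
    simp only [Complex.mul_im, Complex.mul_re, Complex.I_re, Complex.I_im, Complex.ofReal_re,
      Complex.ofReal_im, zero_mul, one_mul, zero_add, mul_zero, sub_zero, add_zero]
    exact ⟨h0, fun _ => h, fun h' => absurd h' hpq⟩
  have outq : ∀ y : ℝ, y ≠ 0 → D.Am < |y| → (D.V / 2 : ℂ) + Complex.I * y ∉ D.sigma :=
    fun y h0 h => by
    rw [notMem_sigma_iff]
    simp only [Complex.add_re, Complex.add_im, qim, qre]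
    simp only [Complex.mul_im, Complex.mul_re, Complex.I_re, Complex.I_im, Complex.ofReal_re,
      Complex.ofReal_im, zero_mul, one_mul, zero_add, mul_zero, sub_zero, add_zero]
    exact ⟨h0, fun h' => absurd h'.symm hpq, fun _ => h⟩
  have hreal : ∀ s : ℝ, s ≠ p → s ≠ q → (s : ℂ) ∈ D.realPart := fun s h1 h2 =>
    ⟨Complex.ofReal_im s, by simpa using h1, by simpa using h2⟩
  have hline : ∀ (s : ℝ) (l : Filter ℝ), l ≤ 𝓝 0 →
      Tendsto (fun y : ℝ => (s + y * Complex.I : ℂ)) l (𝓝 (s : ℂ)) := fun s l hl => by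
    have := (by fun_prop : Continuous fun y : ℝ => (s + y * Complex.I : ℂ)).tendsto 0
    simp only [Complex.ofReal_zero, zero_mul, add_zero] at this
    exact this.mono_left hl
  have vert : ∀ s : ℝ, s ≠ p → s ≠ q → ∀ l : Filter ℝ, (∀ᶠ y in l, y ≠ 0) →
      Tendsto (fun y : ℝ => (1 + y ^ 2)⁻¹) l (𝓝 0) →
      Tendsto (fun y : ℝ => f (s + y * Complex.I)) l (𝓝 0) := fun s h1 h2 l h3 h4 => by
    refine squeeze_zero_norm' (h3.mono fun y hy' => ?_) (by simpa using h4.const_mul (gs s))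
    refine (bound_gs s y h1 h2 hy').trans ?_
    rw [div_eq_mul_inv]
    exact mul_le_mul_of_nonneg_left (inv_anti₀ (by positivity) (sq_im_le s y)) (gs0 s)
  have horiz : ∀ y : ℝ, y ≠ 0 → y ≠ D.Ap → y ≠ -D.Ap → ∀ l : Filter ℝ,
      (∀ᶠ s in l, s ≠ p) → (∀ᶠ s in l, s ≠ q) → Tendsto (fun s : ℝ => (1 + s ^ 2)⁻¹) l (𝓝 0) →
      Tendsto (fun s : ℝ => f (s + y * Complex.I)) l (𝓝 0) := fun y h0 h1 h2 l h3 h3' h4 => by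
    refine squeeze_zero_norm' ((h3.and h3').mono fun s hs => ?_) (by simpa using h4.const_mul (hy y))
    refine (bound_hy s y hs.1 hs.2 h0 h1 h2).trans ?_
    rw [div_eq_mul_inv]
    exact mul_le_mul_of_nonneg_left (inv_anti₀ (by positivity) (sq_re_le s y)) (hy0 y)
  obtain ⟨⟨iU, iL, ilp, irp, ilq, irq⟩, e⟩ := integral_jump_eq_zero hpq (f := f)
    (hf.mono fun z hz => by
      rw [Set.mem_compl_iff, notMem_sigma_iff]
      exact ⟨hz.2.2, fun h => absurd h hz.1, fun h => absurd h hz.2.1⟩) hg hh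
    (by
      filter_upwards [hne_p, hne_q] with s h1 h2 y h3
      refine (bound_gs s y h1 h2 h3).trans ?_
      rw [div_eq_mul_inv]
      exact mul_le_mul_of_nonneg_left (inv_anti₀ (by positivity) (sq_re_le s y)) (gs0 s))
    (by
      filter_upwards [hne_0, hne_A, hne_A'] with y h1 h2 h3 s h4 h5
      refine (bound_hy s y h4 h5 h1 h2 h3).trans ?_
      rw [div_eq_mul_inv]
      exact mul_le_mul_of_nonneg_left (inv_anti₀ (by positivity) (sq_im_le s y)) (hy0 y))
    (U := fun s => fp s) (L := fun s => fm s)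
    (lp := fun y => if |y| < D.Ap then fp (-(D.V / 2 : ℂ) + Complex.I * y)
      else f (-(D.V / 2 : ℂ) + Complex.I * y))
    (rp := fun y => if |y| < D.Ap then fm (-(D.V / 2 : ℂ) + Complex.I * y)
      else f (-(D.V / 2 : ℂ) + Complex.I * y))
    (lq := fun y => if |y| < D.Am then fp ((D.V / 2 : ℂ) + Complex.I * y)
      else f ((D.V / 2 : ℂ) + Complex.I * y))
    (rq := fun y => if |y| < D.Am then fm ((D.V / 2 : ℂ) + Complex.I * y)
      else f ((D.V / 2 : ℂ) + Complex.I * y))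
    (by
      filter_upwards [hne_p, hne_q] with s h1 h2
      refine (hb.left_real _ (hreal s h1 h2)).comp (tendsto_nhdsWithin_iff.2
        ⟨hline s _ nhdsWithin_le_nhds, ?_⟩)
      filter_upwards [self_mem_nhdsWithin] with y hy'
      simpa using hy')
    (by
      filter_upwards [hne_p, hne_q] with s h1 h2
      refine (hb.right_real _ (hreal s h1 h2)).comp (tendsto_nhdsWithin_iff.2
        ⟨hline s _ nhdsWithin_le_nhds, ?_⟩)
      filter_upwards [self_mem_nhdsWithin] with y hy'
      simpa using hy')
    (by
      filter_upwards [hne_p, hne_q] with s h1 h2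
      exact vert s h1 h2 _ (eventually_ne_atTop 0) tendsto_inv_one_add_sq_atTop)
    (by
      filter_upwards [hne_p, hne_q] with s h1 h2
      exact vert s h1 h2 _ (eventually_ne_atBot 0) tendsto_inv_one_add_sq_atBot)
    (by
      filter_upwards [hne_0, hne_A, hne_A'] with y h0 h1 h2
      rw [← pre]
      exact hb.tendsto_left hf.continuousOn (D.mem_cuts_plus y h0) pim
        fun h => outp y h0 (abs_ne h1 h2 h))
    (by
      filter_upwards [hne_0, hne_A, hne_A'] with y h0 h1 h2
      rw [← pre]
      exact hb.tendsto_right hf.continuousOn (D.mem_cuts_plus y h0) pim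
        fun h => outp y h0 (abs_ne h1 h2 h))
    (by
      filter_upwards [hne_0, hne_B, hne_B'] with y h0 h1 h2
      rw [← qre]
      exact hb.tendsto_left hf.continuousOn (D.mem_cuts_minus y h0) qim
        fun h => outq y h0 (abs_ne h1 h2 h))
    (by
      filter_upwards [hne_0, hne_B, hne_B'] with y h0 h1 h2
      rw [← qre]
      exact hb.tendsto_right hf.continuousOn (D.mem_cuts_minus y h0) qim
        fun h => outq y h0 (abs_ne h1 h2 h))
    (by
      filter_upwards [hne_0, hne_A, hne_A'] with y h0 h1 h2
      exact horiz y h0 h1 h2 _ (eventually_ne_atBot p) (eventually_ne_atBot q)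
        tendsto_inv_one_add_sq_atBot)
    (by
      filter_upwards [hne_0, hne_A, hne_A'] with y h0 h1 h2
      exact horiz y h0 h1 h2 _ (eventually_ne_atTop p) (eventually_ne_atTop q)
        tendsto_inv_one_add_sq_atTop)
  obtain ⟨j1, e1⟩ := integral_ite_sub_ite hp.le ilp irp
  obtain ⟨j2, e2⟩ := integral_ite_sub_ite hm.le ilq irq
  refine ⟨⟨iU.sub iL, j1, j2⟩, ?_⟩
  rw [e1, e2] at e
  unfold contourIntegral
  rw [intervalIntegral.integral_mul_const, intervalIntegral.integral_mul_const]
  linear_combination e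

end Data

/-! ### Cauchy's formula for functions without poles -/

theorem one_add_norm_le_mul_norm_sub {z k : ℂ} {ε : ℝ} (hε : 0 < ε) (h : ε ≤ ‖z - k‖) :
    1 + ‖z‖ ≤ ((1 + ‖k‖) / ε + 1) * ‖z - k‖ := by
  have h1 : ‖z‖ ≤ ‖z - k‖ + ‖k‖ := by simpa using norm_add_le (z - k) k
  have h2 : 1 + ‖k‖ ≤ (1 + ‖k‖) / ε * ‖z - k‖ := by
    rw [div_mul_eq_mul_div, le_div_iff₀ hε]
    gcongr
  linarith

theorem integral_inv_one_add_sq_div (a : ℝ) {b : ℝ} (hb : b ≠ 0) :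
    Integrable (fun s : ℝ => ((1 + ((s - a) / b) ^ 2)⁻¹ : ℝ)) ∧
      ∫ s : ℝ, (1 + ((s - a) / b) ^ 2)⁻¹ = |b| * Real.pi := by
  have h1 : Integrable (fun s : ℝ => (1 + (s / b) ^ 2)⁻¹) :=
    integrable_inv_one_add_sq.comp_div hb
  refine ⟨h1.comp_sub_right a, ?_⟩
  rw [integral_sub_right_eq_self (fun s : ℝ => (1 + (s / b) ^ 2)⁻¹) a,
    Measure.integral_comp_div (fun s : ℝ => (1 + s ^ 2)⁻¹) b, integral_univ_inv_one_add_sq,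
    smul_eq_mul]

namespace Data

variable {D : Data}

theorem ae_mem_realPart : ∀ᵐ s : ℝ, (s : ℂ) ∈ D.realPart := by
  filter_upwards [ae_ne (-(D.V / 2)), ae_ne (D.V / 2)] with s h1 h2
  exact ⟨Complex.ofReal_im s, by simpa using h1, by simpa using h2⟩

/-- Only the crossing point `s = 0` and the endpoint `s = A₊` have to be discarded. The second
alternative covers the reversed interval, and positivity of `A₊` excludes it in every application.
-/
theorem ae_mem_cuts_plus : ∀ᵐ s : ℝ, s ∈ Set.uIoc (-D.Ap) D.Ap →
    -(D.V / 2 : ℂ) + Complex.I * s ∈ D.cuts ∨ D.Ap < 0 := by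
  filter_upwards [ae_ne 0, ae_ne D.Ap] with s h0 h1 h
  rcases lt_or_ge D.Ap 0 with h2 | h2
  · exact Or.inr h2
  · rw [Set.uIoc_of_le (by linarith)] at h
    exact Or.inl (D.mem_cuts_plus s h0 (abs_lt.2 ⟨h.1, lt_of_le_of_ne h.2 h1⟩))

theorem ae_mem_cuts_minus : ∀ᵐ s : ℝ, s ∈ Set.uIoc (-D.Am) D.Am →
    (D.V / 2 : ℂ) + Complex.I * s ∈ D.cuts ∨ D.Am < 0 := by
  filter_upwards [ae_ne 0, ae_ne D.Am] with s h0 h1 h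
  rcases lt_or_ge D.Am 0 with h2 | h2
  · exact Or.inr h2
  · rw [Set.uIoc_of_le (by linarith)] at h
    exact Or.inl (D.mem_cuts_minus s h0 (abs_lt.2 ⟨h.1, lt_of_le_of_ne h.2 h1⟩))

theorem ContourIntegrable.congr (hp : 0 < D.Ap) (hm : 0 < D.Am) {F G : ℂ → ℂ}
    (h : ∀ ξ ∈ D.realPart ∪ D.cuts, F ξ = G ξ) (hF : D.ContourIntegrable F) :
    D.ContourIntegrable G := by
  refine ⟨hF.1.congr ?_, hF.2.1.congr_ae ?_, hF.2.2.congr_ae ?_⟩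
  · filter_upwards [ae_mem_realPart (D := D)] with s hs using h _ (Or.inl hs)
  · rw [EventuallyEq, ae_restrict_iff' measurableSet_uIoc]
    filter_upwards [ae_mem_cuts_plus (D := D)] with s hs hs'
    exact h _ (Or.inr ((hs hs').resolve_right hp.not_gt))
  · rw [EventuallyEq, ae_restrict_iff' measurableSet_uIoc]
    filter_upwards [ae_mem_cuts_minus (D := D)] with s hs hs'
    exact h _ (Or.inr ((hs hs').resolve_right hm.not_gt))

theorem contourIntegral_congr (hp : 0 < D.Ap) (hm : 0 < D.Am) {F G : ℂ → ℂ}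
    (h : ∀ ξ ∈ D.realPart ∪ D.cuts, F ξ = G ξ) :
    D.contourIntegral F = D.contourIntegral G := by
  unfold contourIntegral
  congr 1
  · congr 1
    · refine integral_congr_ae ?_
      filter_upwards [ae_mem_realPart (D := D)] with s hs using h _ (Or.inl hs)
    · refine intervalIntegral.integral_congr_ae ?_
      filter_upwards [ae_mem_cuts_plus (D := D)] with s hs hs'
      rw [h _ (Or.inr ((hs hs').resolve_right hp.not_gt))]
  · refine intervalIntegral.integral_congr_ae ?_
    filter_upwards [ae_mem_cuts_minus (D := D)] with s hs hs'
    rw [h _ (Or.inr ((hs hs').resolve_right hm.not_gt))]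

theorem ContourIntegrable.add {F G : ℂ → ℂ} (hF : D.ContourIntegrable F)
    (hG : D.ContourIntegrable G) : D.ContourIntegrable (fun ξ => F ξ + G ξ) :=
  ⟨hF.1.add hG.1, hF.2.1.add hG.2.1, hF.2.2.add hG.2.2⟩

theorem contourIntegral_add {F G : ℂ → ℂ} (hF : D.ContourIntegrable F)
    (hG : D.ContourIntegrable G) : D.contourIntegral (fun ξ => F ξ + G ξ) =
      D.contourIntegral F + D.contourIntegral G := by
  unfold contourIntegral
  simp only [add_mul]
  rw [integral_add hF.1 hG.1,
    intervalIntegral.integral_add (hF.2.1.mul_const _) (hG.2.1.mul_const _),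
    intervalIntegral.integral_add (hF.2.2.mul_const _) (hG.2.2.mul_const _)]
  ring

theorem im_ne_zero_of_mem_cuts {ξ : ℂ} (h : ξ ∈ D.cuts) : ξ.im ≠ 0 := by
  rcases h with ((h | h) | h) | h
  · exact h.2.1.ne'
  · exact h.2.2.ne
  · exact h.2.1.ne'
  · exact h.2.2.ne

theorem mem_sigma_of_mem {ξ : ℂ} (h : ξ ∈ D.realPart ∪ D.cuts) : ξ ∈ D.sigma := by
  rcases h with h | ((h | h) | h) | h
  · exact Or.inl (Or.inl h.1)
  · exact Or.inl (Or.inr ⟨h.1, abs_le.2 ⟨by linarith [h.2.1, h.2.2], h.2.2.le⟩⟩)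
  · exact Or.inl (Or.inr ⟨h.1, abs_le.2 ⟨h.2.1.le, by linarith [h.2.1, h.2.2]⟩⟩)
  · exact Or.inr ⟨h.1, abs_le.2 ⟨by linarith [h.2.1, h.2.2], h.2.2.le⟩⟩
  · exact Or.inr ⟨h.1, abs_le.2 ⟨h.2.1.le, by linarith [h.2.1, h.2.2]⟩⟩

/-- A function supported on the real line, up to finitely many points. -/
theorem contourIntegral_of_eq_zero (hp : 0 < D.Ap) (hm : 0 < D.Am) {F : ℂ → ℂ}
    (h : ∀ ξ ∈ D.cuts, F ξ = 0) (hF : Integrable fun s : ℝ => F s) :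
    D.ContourIntegrable F ∧ D.contourIntegral F = ∫ s : ℝ, F s := by
  have h1 : ∀ᵐ s : ℝ, s ∈ Set.uIoc (-D.Ap) D.Ap → (0 : ℂ) = F (-(D.V / 2 : ℂ) + Complex.I * s) := by
    filter_upwards [ae_mem_cuts_plus (D := D)] with s hs hs'
    exact (h _ ((hs hs').resolve_right hp.not_gt)).symm
  have h2 : ∀ᵐ s : ℝ, s ∈ Set.uIoc (-D.Am) D.Am → (0 : ℂ) = F ((D.V / 2 : ℂ) + Complex.I * s) := by
    filter_upwards [ae_mem_cuts_minus (D := D)] with s hs hs'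
    exact (h _ ((hs hs').resolve_right hm.not_gt)).symm
  refine ⟨⟨hF, ?_, ?_⟩, ?_⟩
  · exact (intervalIntegrable_const (c := (0 : ℂ))).congr_ae
      ((ae_restrict_iff' measurableSet_uIoc).2 h1)
  · exact (intervalIntegrable_const (c := (0 : ℂ))).congr_ae
      ((ae_restrict_iff' measurableSet_uIoc).2 h2)
  · unfold contourIntegral
    rw [intervalIntegral.integral_mul_const, intervalIntegral.integral_mul_const,
      ← intervalIntegral.integral_congr_ae h1, ← intervalIntegral.integral_congr_ae h2]
    simp

/-- The function `c / (z - conj k)` on the half plane of `k`, extended by zero. -/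
def halfPole (c k z : ℂ) : ℂ := if 0 < z.im * k.im then c / (z - conj k) else 0

/-- The boundary values of `halfPole`; on the real line `ε = 1` stands for the value from above
and `ε = -1` for the value from below. -/
def halfPoleBoundary (ε : ℝ) (c k z : ℂ) : ℂ :=
  if z.im = 0 then (if 0 < ε * k.im then c / (z - conj k) else 0) else halfPole c k z

theorem sub_conj_ne_zero {k z : ℂ} (hk : k.im ≠ 0) (h : 0 ≤ z.im * k.im) : z - conj k ≠ 0 := by
  intro h'
  have h1 := congrArg Complex.im h'
  simp only [Complex.sub_im, Complex.conj_im, sub_neg_eq_add, Complex.zero_im] at h1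
  have h2 : z.im = -k.im := by linarith
  rw [h2] at h
  have : 0 < k.im * k.im := mul_self_pos.2 hk
  linarith

theorem halfPole_eventuallyEq_pos {c k z : ℂ} (h : 0 < z.im * k.im) :
    halfPole c k =ᶠ[𝓝 z] fun w => c / (w - conj k) := by
  have : ∀ᶠ w : ℂ in 𝓝 z, 0 < w.im * k.im :=
    (by fun_prop : Continuous fun w : ℂ => w.im * k.im).continuousAt.eventually_const_lt h
  filter_upwards [this] with w hw
  simp [halfPole, hw]

theorem halfPole_eventuallyEq_neg {c k z : ℂ} (h : z.im * k.im < 0) :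
    halfPole c k =ᶠ[𝓝 z] fun _ => 0 := by
  have : ∀ᶠ w : ℂ in 𝓝 z, w.im * k.im < 0 :=
    (by fun_prop : Continuous fun w : ℂ => w.im * k.im).continuousAt.eventually_lt_const h
  filter_upwards [this] with w hw
  simp [halfPole, hw.not_gt]

theorem differentiableAt_halfPole (c : ℂ) {k z : ℂ} (hk : k.im ≠ 0) (hz : z.im ≠ 0) :
    DifferentiableAt ℂ (halfPole c k) z := by
  rcases lt_or_gt_of_ne (mul_ne_zero hz hk) with h | h
  · exact (halfPole_eventuallyEq_neg h).differentiableAt_iff.2 (differentiableAt_const _)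
  · refine (halfPole_eventuallyEq_pos h).differentiableAt_iff.2 ?_
    exact (differentiableAt_const _).div (differentiableAt_id.sub_const _) (sub_conj_ne_zero hk h.le)

theorem tendsto_halfPole (c : ℂ) {k z : ℂ} (hk : k.im ≠ 0) (hz : z.im = 0) {ε : ℝ} (hε : ε ≠ 0) :
    Tendsto (halfPole c k) (𝓝[{w | 0 < ε * w.im}] z) (𝓝 (halfPoleBoundary ε c k z)) := by
  unfold halfPoleBoundary
  rw [if_pos hz]
  split_ifs with h
  · have hz0 : z - conj k ≠ 0 := sub_conj_ne_zero hk (by simp [hz])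
    have hc : ContinuousAt (fun w : ℂ => c / (w - conj k)) z :=
      continuousAt_const.div (by fun_prop) hz0
    refine (hc.tendsto.mono_left nhdsWithin_le_nhds).congr' ?_
    filter_upwards [self_mem_nhdsWithin] with w hw
    have : 0 < w.im * k.im := by
      have h1 : 0 < (ε * w.im) * (ε * k.im) := mul_pos hw h
      have h2 : 0 < ε * ε := mul_self_pos.2 hε
      by_contra h3
      nlinarith
    simp [halfPole, this]
  · refine tendsto_const_nhds.congr' ?_
    filter_upwards [self_mem_nhdsWithin] with w hw
    have : ¬ 0 < w.im * k.im := by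
      intro h3
      refine h ?_
      have h2 : 0 < ε * ε := mul_self_pos.2 hε
      have h1 : 0 < ε * w.im := hw
      have h4 : 0 < (ε * w.im) * (ε * k.im) := by nlinarith
      exact pos_of_mul_pos_right h4 h1.le
    simp [halfPole, this]

theorem hasBoundaryValues_halfPole (c : ℂ) {k : ℂ} (hk : k.im ≠ 0) :
    D.HasBoundaryValues (halfPole c k) (halfPoleBoundary 1 c k) (halfPoleBoundary (-1) c k) where
  left_real z hz := by simpa using tendsto_halfPole c hk hz.1 one_ne_zero
  right_real z hz := by simpa using tendsto_halfPole c hk hz.1 (ε := -1) (by norm_num)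
  left_cuts z hz := by
    have h := im_ne_zero_of_mem_cuts hz
    rw [halfPoleBoundary, if_neg h]
    exact (differentiableAt_halfPole c hk h).continuousAt.tendsto.mono_left nhdsWithin_le_nhds
  right_cuts z hz := by
    have h := im_ne_zero_of_mem_cuts hz
    rw [halfPoleBoundary, if_neg h]
    exact (differentiableAt_halfPole c hk h).continuousAt.tendsto.mono_left nhdsWithin_le_nhds

/-- On the half plane of `k` the distance to the reflected point `conj k` is at least `|Im k|`. -/
theorem norm_halfPole_le (c : ℂ) {k : ℂ} (hk : k.im ≠ 0) :
    ∃ C, 0 ≤ C ∧ ∀ z, ‖halfPole c k z‖ ≤ C / (1 + ‖z‖) := by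
  have hk' : 0 < |k.im| := abs_pos.2 hk
  refine ⟨‖c‖ * ((1 + ‖conj k‖) / |k.im| + 1), by positivity, fun z => ?_⟩
  unfold halfPole
  split_ifs with h
  · have h1 : |k.im| ≤ ‖z - conj k‖ := by
      refine le_trans ?_ (Complex.abs_im_le_norm _)
      simp only [Complex.sub_im, Complex.conj_im, sub_neg_eq_add]
      rcases pos_and_pos_or_neg_and_neg_of_mul_pos h with ⟨h2, h3⟩ | ⟨h2, h3⟩
      · rw [abs_of_pos h3, abs_of_pos (by linarith)]; linarith
      · rw [abs_of_neg h3, abs_of_neg (by linarith)]; linarith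
    have h2 := one_add_norm_le_mul_norm_sub hk' h1
    have h3 : 0 < ‖z - conj k‖ := hk'.trans_le h1
    rw [norm_div, div_le_div_iff₀ h3 (by positivity), mul_assoc]
    gcongr
  · rw [norm_zero]; positivity

/-- For real `s` one has `(s - conj k)(s - k) = (s - Re k)² + (Im k)²`. The jump divided by `s - k`
is thus a constant times the Poisson kernel of `k`, with a sign that depends on the half plane
containing `k`. -/
theorem integral_halfPoleBoundary (c : ℂ) {k : ℂ} (hk : k.im ≠ 0) :
    Integrable (fun s : ℝ => (halfPoleBoundary 1 c k s - halfPoleBoundary (-1) c k s) / (s - k)) ∧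
    (k - conj k) * ∫ s : ℝ, (halfPoleBoundary 1 c k s - halfPoleBoundary (-1) c k s) / (s - k)
      = 2 * Real.pi * Complex.I * c := by
  obtain ⟨hi, he⟩ := integral_inv_one_add_sq_div k.re hk
  have key : ∀ s : ℝ, (halfPoleBoundary 1 c k s - halfPoleBoundary (-1) c k s) / (s - k)
      = (c / ((|k.im| * k.im : ℝ) : ℂ)) * (((1 + ((s - k.re) / k.im) ^ 2)⁻¹ : ℝ) : ℂ) := by
    intro s
    have h1 : (s : ℂ) - k ≠ 0 := fun h => hk (by simpa using congrArg Complex.im h)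
    have h2 : (s : ℂ) - conj k ≠ 0 := sub_conj_ne_zero hk (by simp)
    have h3 : ((s : ℂ) - conj k) * (s - k) = (((s - k.re) ^ 2 + k.im ^ 2 : ℝ) : ℂ) := by
      apply Complex.ext
      · simp [pow_two]
      · simp [pow_two]
        ring
    have h4 : 0 < (s - k.re) ^ 2 + k.im ^ 2 := by positivity
    have h5 : (1 + ((s - k.re) / k.im) ^ 2)⁻¹ = k.im ^ 2 * ((s - k.re) ^ 2 + k.im ^ 2)⁻¹ := by
      field_simp
      ring
    have h6 : c / (s - conj k) / (s - k) =
        c * ((((s - k.re) ^ 2 + k.im ^ 2 : ℝ) : ℂ))⁻¹ := by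
      rw [div_div, h3, div_eq_mul_inv]
    have hk' : (k.im : ℂ) ≠ 0 := by exact_mod_cast hk
    rw [h5]
    simp only [halfPoleBoundary, Complex.ofReal_im, if_true, one_mul, neg_mul]
    rcases lt_or_gt_of_ne hk with h | h
    · rw [if_neg h.not_gt, if_pos (by linarith), zero_sub, neg_div, h6, abs_of_neg h]
      push_cast
      field_simp
    · rw [if_pos h, if_neg (by linarith), sub_zero, h6, abs_of_pos h]
      push_cast
      field_simp
  simp_rw [key]
  refine ⟨hi.ofReal.const_mul _, ?_⟩
  rw [integral_const_mul, integral_complex_ofReal, he]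
  have hk' : (k.im : ℂ) ≠ 0 := by exact_mod_cast hk
  have hk'' : ((|k.im| : ℝ) : ℂ) ≠ 0 := by exact_mod_cast (abs_pos.2 hk).ne'
  rw [Complex.sub_conj]
  push_cast
  field_simp

variable (D) in
/-- **Cauchy's formula** for the complement of the contour. -/
theorem cauchy_of_norm_le (hV : D.V ≠ 0) (hp : 0 < D.Ap) (hm : 0 < D.Am)
    {f fp fm : ℂ → ℂ} (hf : DifferentiableOn ℂ f D.sigmaᶜ) (hb : D.HasBoundaryValues f fp fm)
    {C : ℝ} (hC0 : 0 ≤ C) (hC : ∀ z ∉ D.sigma, ‖f z‖ ≤ C * D.weight z / (1 + ‖z‖))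
    {k : ℂ} (hk : k ∉ D.sigma) :
    D.ContourIntegrable (fun ξ => (fp ξ - fm ξ) / (ξ - k)) ∧
      D.contourIntegral (fun ξ => (fp ξ - fm ξ) / (ξ - k)) = 2 * Real.pi * Complex.I * f k := by
  have hk0 : k.im ≠ 0 := (D.notMem_sigma_iff.1 hk).1
  have hko : D.sigmaᶜ ∈ 𝓝 k := D.isClosed_sigma.isOpen_compl.mem_nhds hk
  -- This residue at `conj k` makes the value of `halfPole c k` at `k` equal to `f k`.
  set c := f k * (k - conj k) with hc
  have hkc : k - conj k ≠ 0 := sub_conj_ne_zero hk0 (mul_self_pos.2 hk0).le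
  set h : ℂ → ℂ := fun z => f z - halfPole c k z with hh
  have hhk : h k = 0 := by
    simp only [hh, halfPole, if_pos (mul_self_pos.2 hk0), hc]
    field_simp
    simp
  have hhd : DifferentiableOn ℂ h D.sigmaᶜ := fun z hz =>
    (hf z hz).sub (differentiableAt_halfPole c hk0 (D.notMem_sigma_iff.1 hz).1).differentiableWithinAt
  -- Since `h` vanishes at `k`, its difference quotient there is `h z / (z - k)` with the
  -- singularity removed.
  have hφd : DifferentiableOn ℂ (dslope h k) D.sigmaᶜ :=
    (Complex.differentiableOn_dslope hko).2 hhd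
  have hφ : ∀ z, z ≠ k → dslope h k z = h z / (z - k) := fun z hz => by
    rw [dslope_of_ne _ hz, slope_def_field, hhk, sub_zero]
  have hpole := hasBoundaryValues_halfPole (D := D) c hk0
  set φp : ℂ → ℂ := fun ξ => (fp ξ - halfPoleBoundary 1 c k ξ) / (ξ - k) with hφp
  set φm : ℂ → ℂ := fun ξ => (fm ξ - halfPoleBoundary (-1) c k ξ) / (ξ - k) with hφm
  have lim : ∀ {ξ : ℂ} {l : Filter ℂ} {a b : ℂ}, ξ ∈ D.sigma → l ≤ 𝓝 ξ → Tendsto f l (𝓝 a) →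
      Tendsto (halfPole c k) l (𝓝 b) → Tendsto (dslope h k) l (𝓝 ((a - b) / (ξ - k))) := by
    intro ξ l a b hξ hl h1 h2
    have hne : ξ ≠ k := fun h => hk (h ▸ hξ)
    refine ((h1.sub h2).div ((tendsto_id.mono_left hl).sub_const k) (sub_ne_zero.2 hne)).congr' ?_
    filter_upwards [hl (isOpen_ne.mem_nhds hne)] with z hz
    rw [hφ z hz]
    rfl
  have hφb : D.HasBoundaryValues (dslope h k) φp φm :=
    ⟨fun ξ hξ => lim (mem_sigma_of_mem (Or.inl hξ)) nhdsWithin_le_nhds (hb.left_real ξ hξ)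
        (hpole.left_real ξ hξ),
      fun ξ hξ => lim (mem_sigma_of_mem (Or.inl hξ)) nhdsWithin_le_nhds (hb.right_real ξ hξ)
        (hpole.right_real ξ hξ),
      fun ξ hξ => lim (mem_sigma_of_mem (Or.inr hξ)) nhdsWithin_le_nhds (hb.left_cuts ξ hξ)
        (hpole.left_cuts ξ hξ),
      fun ξ hξ => lim (mem_sigma_of_mem (Or.inr hξ)) nhdsWithin_le_nhds (hb.right_cuts ξ hξ)
        (hpole.right_cuts ξ hξ)⟩
  obtain ⟨C1, hC1, hC1'⟩ := norm_halfPole_le c hk0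
  obtain ⟨ε, hε, hεs⟩ := Metric.nhds_basis_closedBall.mem_iff.1 hko
  obtain ⟨B, hB⟩ := (isCompact_closedBall k ε).exists_bound_of_continuousOn
    (hφd.continuousOn.mono hεs)
  have hB0 : 0 ≤ B := (norm_nonneg _).trans (hB k (Metric.mem_closedBall_self hε.le))
  -- The first summand of the constant serves the compact ball around `k`. The second serves its
  -- complement, where dividing by `z - k` gains one more order of decay.
  have bound : ∀ z ∉ D.sigma, ‖dslope h k z‖ ≤
      (B * (1 + ‖k‖ + ε) ^ 2 + (C + C1) * ((1 + ‖k‖) / ε + 1)) * D.weight z / (1 + ‖z‖) ^ 2 := by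
    intro z hz
    have hw := D.one_le_weight z
    have hz0 : 0 < 1 + ‖z‖ := by positivity
    rw [le_div_iff₀ (by positivity)]
    by_cases hzk : z ∈ Metric.closedBall k ε
    · have h1 : 1 + ‖z‖ ≤ 1 + ‖k‖ + ε := by
        have := norm_le_norm_add_norm_sub' z k
        rw [mem_closedBall_iff_norm] at hzk
        linarith
      calc ‖dslope h k z‖ * (1 + ‖z‖) ^ 2 ≤ B * (1 + ‖k‖ + ε) ^ 2 := by
            gcongr; exact hB z hzk
        _ ≤ B * (1 + ‖k‖ + ε) ^ 2 + (C + C1) * ((1 + ‖k‖) / ε + 1) := by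
            have : 0 ≤ (C + C1) * ((1 + ‖k‖) / ε + 1) := by positivity
            linarith
        _ ≤ _ := le_mul_of_one_le_right (by positivity) hw
    · have h0 : ε ≤ ‖z - k‖ := by
        rw [mem_closedBall_iff_norm, not_le] at hzk; exact hzk.le
      have hzk' : 0 < ‖z - k‖ := hε.trans_le h0
      have h1 := one_add_norm_le_mul_norm_sub hε h0
      have h2 : ‖h z‖ * (1 + ‖z‖) ≤ (C + C1) * D.weight z := by
        rw [← le_div_iff₀ hz0]
        calc ‖h z‖ ≤ ‖f z‖ + ‖halfPole c k z‖ := norm_sub_le _ _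
          _ ≤ C * D.weight z / (1 + ‖z‖) + C1 / (1 + ‖z‖) := add_le_add (hC z hz) (hC1' z)
          _ ≤ C * D.weight z / (1 + ‖z‖) + C1 * D.weight z / (1 + ‖z‖) := by
            gcongr; exact le_mul_of_one_le_right hC1 hw
          _ = _ := by ring
      rw [hφ z (sub_ne_zero.1 (norm_pos_iff.1 hzk')), norm_div]
      calc ‖h z‖ / ‖z - k‖ * (1 + ‖z‖) ^ 2
          = (‖h z‖ * (1 + ‖z‖)) * ((1 + ‖z‖) / ‖z - k‖) := by ring
        _ ≤ ((C + C1) * D.weight z) * ((1 + ‖k‖) / ε + 1) := by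
            gcongr
            rwa [div_le_iff₀ hzk']
        _ = (C + C1) * ((1 + ‖k‖) / ε + 1) * D.weight z := by ring
        _ ≤ _ := by
            gcongr
            exact le_add_of_nonneg_left (by positivity)
  obtain ⟨i1, e1⟩ := contourIntegral_jump_eq_zero hV hp hm hφd hφb (by positivity) bound
  obtain ⟨j, e⟩ := integral_halfPoleBoundary c hk0
  obtain ⟨i2, e2⟩ := contourIntegral_of_eq_zero (D := D) hp hm
    (F := fun ξ => (halfPoleBoundary 1 c k ξ - halfPoleBoundary (-1) c k ξ) / (ξ - k))
    (fun ξ hξ => by simp [halfPoleBoundary, im_ne_zero_of_mem_cuts hξ]) j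
  -- The first part has integral zero, and the second is the explicit integral over the real line
  -- that produces `2πi f(k)`.
  have hsum : (fun ξ => (fp ξ - fm ξ) / (ξ - k)) = fun ξ => (φp ξ - φm ξ) +
      (halfPoleBoundary 1 c k ξ - halfPoleBoundary (-1) c k ξ) / (ξ - k) := by
    funext ξ
    simp only [hφp, hφm]
    ring
  rw [hsum]
  refine ⟨i1.add i2, ?_⟩
  rw [contourIntegral_add i1 i2, e1, e2, zero_add]
  apply mul_left_cancel₀ hkc
  rw [e, hc]
  ring

end Data

/-! ### From local growth conditions to a global bound -/

theorem isBigO_div_sub_cobounded (r a : ℂ) :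
    (fun z : ℂ => r / (z - a)) =O[Bornology.cobounded ℂ] (fun z => z⁻¹) := by
  refine IsBigO.of_bound (‖r‖ * 2) ?_
  have h : ∀ᶠ z : ℂ in Bornology.cobounded ℂ, 2 * ‖a‖ + 1 ≤ ‖z‖ :=
    tendsto_norm_cobounded_atTop.eventually_ge_atTop _
  filter_upwards [h] with z hz
  have h0 : 0 < ‖z‖ := by linarith [norm_nonneg a]
  have h1 : ‖z‖ / 2 ≤ ‖z - a‖ := by
    have := norm_sub_norm_le z a
    linarith
  rw [norm_div, norm_inv, mul_assoc, div_eq_mul_inv]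
  refine mul_le_mul_of_nonneg_left ?_ (norm_nonneg r)
  calc ‖z - a‖⁻¹ ≤ (‖z‖ / 2)⁻¹ := inv_anti₀ (by positivity) h1
    _ = 2 * ‖z‖⁻¹ := by rw [inv_div, div_eq_mul_inv]

/-- The growth estimates use only this modulus, so the position of the branch cut plays no role in
them. -/
theorem norm_rootDown (z : ℂ) : ‖rootDown z‖ = ‖z‖ ^ (1 / 4 : ℝ) := by
  unfold rootDown
  have h : ((1 / 4 : ℂ)) = ((1 / 4 : ℝ) : ℂ) := by norm_num
  rw [norm_mul, mul_comm Complex.I, Complex.norm_exp_ofReal_mul_I, one_mul, h,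
    Complex.norm_cpow_real]
  simp

theorem norm_rootUp (z : ℂ) : ‖rootUp z‖ = ‖z‖ ^ (1 / 4 : ℝ) := by
  unfold rootUp
  rw [RCLike.norm_conj, norm_rootDown, RCLike.norm_conj]

namespace Data

variable {D : Data}

theorem isBigO_weight_of_isBigO_one {f : ℂ → ℂ} {l : Filter ℂ}
    (h : f =O[l] (fun _ => (1 : ℝ))) : f =O[l] D.weight :=
  h.trans (IsBigO.of_bound 1 (Eventually.of_forall fun z => by
    rw [Real.norm_of_nonneg (D.weight_pos z).le, norm_one, one_mul]
    exact D.one_le_weight z))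

theorem isBigO_weight_of_tendsto {f : ℂ → ℂ} {l : Filter ℂ} {a : ℂ} (h : Tendsto f l (𝓝 a)) :
    f =O[l] D.weight :=
  isBigO_weight_of_isBigO_one (h.isBigO_one ℝ)

variable (D) in
/-- The branch points and the crossing points of the contour. -/
def singularPoints : Set ℂ :=
  {D.pPlus, conj D.pPlus, D.pMinus, conj D.pMinus, -(D.V / 2 : ℂ), (D.V / 2 : ℂ)}

theorem mem_of_mem_sigma {z : ℂ} (hz : z ∈ D.sigma) :
    z ∈ D.realPart ∪ D.cuts ∨ z ∈ D.singularPoints := by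
  by_cases h0 : z.im = 0
  · by_cases h1 : z.re = -(D.V / 2)
    · right
      have : z = -(D.V / 2 : ℂ) := Complex.ext
        (by simp [h1, Complex.div_ofNat_re]) (by simp [h0, Complex.div_ofNat_im])
      simp [singularPoints, this]
    · by_cases h2 : z.re = D.V / 2
      · right
        have : z = (D.V / 2 : ℂ) := Complex.ext
          (by simp [h2, Complex.div_ofNat_re]) (by simp [h0, Complex.div_ofNat_im])
        simp [singularPoints, this]
      · exact Or.inl (Or.inl ⟨h0, h1, h2⟩)
  · rcases hz with (hz | ⟨h1, h2⟩) | ⟨h1, h2⟩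
    · exact absurd hz h0
    · rcases h2.lt_or_eq with h2 | h2
      · have := D.mem_cuts_plus z.im h0 h2
        have e : -(D.V / 2 : ℂ) + Complex.I * z.im = z := Complex.ext
          (by simp [h1, Complex.div_ofNat_re]) (by simp [Complex.div_ofNat_im])
        exact Or.inl (Or.inr (e ▸ this))
      · right
        rcases eq_or_eq_neg_of_abs_eq h2 with h3 | h3
        · exact Or.inl (Complex.ext (by simp [h1]) (by simp [h3]))
        · exact Or.inr (Or.inl (Complex.ext (by simp [h1]) (by simp [h3])))
    · rcases h2.lt_or_eq with h2 | h2
      · have := D.mem_cuts_minus z.im h0 h2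
        have e : (D.V / 2 : ℂ) + Complex.I * z.im = z := Complex.ext
          (by simp [h1, Complex.div_ofNat_re]) (by simp [Complex.div_ofNat_im])
        exact Or.inl (Or.inr (e ▸ this))
      · right
        rcases eq_or_eq_neg_of_abs_eq h2 with h3 | h3
        · exact Or.inr (Or.inr (Or.inl (Complex.ext (by simp [h1]) (by simp [h3]))))
        · exact Or.inr (Or.inr (Or.inr (Or.inl (Complex.ext (by simp [h1]) (by simp [h3])))))

theorem nhdsWithin_compl_sigma_le_im (z : ℂ) :
    𝓝[D.sigmaᶜ] z ≤ 𝓝[{w | 0 < w.im}] z ⊔ 𝓝[{w | w.im < 0}] z := by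
  rw [← nhdsWithin_union]
  refine nhdsWithin_mono _ fun w hw => ?_
  exact (lt_or_gt_of_ne (D.notMem_sigma_iff.1 hw).1).symm

/-- Near an interior point of a cut, a point on the same vertical line still lies on the cut; a
nearby point off the contour is hence strictly to the left or to the right. -/
theorem nhdsWithin_compl_sigma_le_of_mem_cuts {z : ℂ} (hz : z ∈ D.cuts) :
    𝓝[D.sigmaᶜ] z ≤ 𝓝[{w | w.re < z.re}] z ⊔ 𝓝[{w | z.re < w.re}] z := by
  have h : (z.re = -(D.V / 2) ∧ |z.im| < D.Ap) ∨ (z.re = D.V / 2 ∧ |z.im| < D.Am) := by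
    rcases hz with ((h | h) | h) | h
    · exact Or.inl ⟨h.1, abs_lt.2 ⟨by linarith [h.2.1, h.2.2], h.2.2⟩⟩
    · exact Or.inl ⟨h.1, abs_lt.2 ⟨h.2.1, by linarith [h.2.1, h.2.2]⟩⟩
    · exact Or.inr ⟨h.1, abs_lt.2 ⟨by linarith [h.2.1, h.2.2], h.2.2⟩⟩
    · exact Or.inr ⟨h.1, abs_lt.2 ⟨h.2.1, by linarith [h.2.1, h.2.2]⟩⟩
  rw [← nhdsWithin_union]
  refine nhdsWithin_le_iff.2 ?_
  have hc : ContinuousAt (fun w : ℂ => |w.im|) z := Complex.continuous_im.abs.continuousAt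
  rcases h with ⟨h1, h2⟩ | ⟨h1, h2⟩
  · filter_upwards [self_mem_nhdsWithin, nhdsWithin_le_nhds (hc.eventually_lt_const h2)] with w hw h3
    change w.re < z.re ∨ z.re < w.re
    refine lt_or_gt_of_ne fun h4 => ?_
    exact ((D.notMem_sigma_iff.1 hw).2.1 (h4.trans h1)).not_gt h3
  · filter_upwards [self_mem_nhdsWithin, nhdsWithin_le_nhds (hc.eventually_lt_const h2)] with w hw h3
    change w.re < z.re ∨ z.re < w.re
    refine lt_or_gt_of_ne fun h4 => ?_
    exact ((D.notMem_sigma_iff.1 hw).2.2 (h4.trans h1)).not_gt h3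

theorem HasBoundaryValues.isBigO_weight {f fp fm : ℂ → ℂ} (hb : D.HasBoundaryValues f fp fm)
    {z : ℂ} (hz : z ∈ D.realPart ∪ D.cuts) : f =O[𝓝[D.sigmaᶜ] z] D.weight := by
  rcases hz with hz | hz
  · exact ((isBigO_weight_of_tendsto (hb.left_real z hz)).sup
      (isBigO_weight_of_tendsto (hb.right_real z hz))).mono
      (nhdsWithin_compl_sigma_le_im z)
  · exact ((isBigO_weight_of_tendsto (hb.left_cuts z hz)).sup
      (isBigO_weight_of_tendsto (hb.right_cuts z hz))).mono
      (nhdsWithin_compl_sigma_le_of_mem_cuts hz)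

/-- Compactness of a large disc turns the local bounds into one constant, and the decay at infinity
handles the exterior. The radius is at least 1, so that `1 + ‖z‖ ≤ 2‖z‖` outside. -/
theorem exists_norm_le_weight {f : ℂ → ℂ} (hloc : ∀ z, f =O[𝓝[D.sigmaᶜ] z] D.weight)
    (hinf : f =O[Bornology.cobounded ℂ ⊓ 𝓟 D.sigmaᶜ] (fun k => k⁻¹)) :
    ∃ C, 0 ≤ C ∧ ∀ z ∉ D.sigma, ‖f z‖ ≤ C * D.weight z / (1 + ‖z‖) := by
  obtain ⟨C1, hC1, h1⟩ := hinf.exists_nonneg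
  rw [isBigOWith_iff, eventually_inf_principal, ← comap_norm_atTop, eventually_comap] at h1
  obtain ⟨R, hR⟩ := eventually_atTop.1 h1
  have h2 : ∃ C, 0 ≤ C ∧ ∀ z ∈ Metric.closedBall (0 : ℂ) (max R 1), z ∉ D.sigma →
      ‖f z‖ ≤ C * D.weight z := by
    refine (isCompact_closedBall (0 : ℂ) (max R 1)).induction_on
      (p := fun s => ∃ C, 0 ≤ C ∧ ∀ z ∈ s, z ∉ D.sigma → ‖f z‖ ≤ C * D.weight z)
      ⟨0, le_rfl, by simp⟩ ?_ ?_ ?_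
    · rintro s t hst ⟨C, h0, h⟩
      exact ⟨C, h0, fun z hz => h z (hst hz)⟩
    · rintro s t ⟨C, h0, h⟩ ⟨C', h0', h'⟩
      refine ⟨C + C', by positivity, ?_⟩
      rintro z (hz | hz) hzs
      · refine (h z hz hzs).trans ?_
        have := D.weight_pos z
        gcongr
        linarith
      · refine (h' z hz hzs).trans ?_
        have := D.weight_pos z
        gcongr
        linarith
    · intro z _
      obtain ⟨C, hC, h⟩ := (hloc z).exists_nonneg
      rw [isBigOWith_iff, eventually_nhdsWithin_iff] at h
      refine ⟨_, nhdsWithin_le_nhds h, C, hC, fun w hw hws => ?_⟩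
      have := hw hws
      rwa [Real.norm_of_nonneg (D.weight_pos w).le] at this
  obtain ⟨C2, hC2, h2⟩ := h2
  refine ⟨C1 * 2 + C2 * (1 + max R 1), by positivity, fun z hz => ?_⟩
  have hw := D.one_le_weight z
  have hw0 := D.weight_pos z
  have hz0 : 0 < 1 + ‖z‖ := by positivity
  rw [le_div_iff₀ hz0]
  by_cases hzR : ‖z‖ ≤ max R 1
  · calc ‖f z‖ * (1 + ‖z‖) ≤ (C2 * D.weight z) * (1 + max R 1) := by
          gcongr
          exact h2 z (by simpa using hzR) hz
      _ = C2 * (1 + max R 1) * D.weight z := by ring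
      _ ≤ _ := by
          gcongr
          exact le_add_of_nonneg_left (by positivity)
  · rw [not_le, max_lt_iff] at hzR
    have h3 := hR ‖z‖ hzR.1.le z rfl hz
    rw [norm_inv] at h3
    have hz1 : 0 < ‖z‖ := by linarith
    calc ‖f z‖ * (1 + ‖z‖) ≤ (C1 * ‖z‖⁻¹) * (‖z‖ + ‖z‖) := by
          gcongr
          exact hzR.2.le
      _ = C1 * 2 := by field_simp; ring
      _ ≤ C1 * 2 + C2 * (1 + max R 1) := le_add_of_nonneg_right (by positivity)
      _ ≤ _ := le_mul_of_one_le_right (by positivity) hw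

/-! ### Cauchy's formula with simple poles -/

/-- **Cauchy's formula** for the complement of the contour, in the presence of simple poles. -/
theorem cauchy_of_simple_poles (hV : D.V ≠ 0) (hp : 0 < D.Ap) (hm : 0 < D.Am)
    {N : ℕ} {a res : Fin N → ℂ} (ha : Function.Injective a) (haS : ∀ n, a n ∉ D.sigma)
    {f fp fm : ℂ → ℂ} {c : ℂ}
    (hf : ∀ z ∉ D.sigma, z ∉ Set.range a → DifferentiableAt ℂ f z)
    (hres : ∀ n, Tendsto (fun z => (z - a n) * f z) (𝓝[≠] (a n)) (𝓝 (res n)))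
    (hb : D.HasBoundaryValues f fp fm)
    (hW : ∀ z ∈ D.singularPoints, f =O[𝓝[D.sigmaᶜ] z] D.weight)
    (hinf : (fun z => f z - c) =O[Bornology.cobounded ℂ ⊓ 𝓟 D.sigmaᶜ] (fun z => z⁻¹))
    {k : ℂ} (hk : k ∉ D.sigma) :
    D.ContourIntegrable (fun ξ => (fp ξ - fm ξ) / (ξ - k)) ∧
      (k ∉ Set.range a → f k = c + ∑ n, res n / (k - a n) + (2 * Real.pi * Complex.I)⁻¹ *
        D.contourIntegral (fun ξ => (fp ξ - fm ξ) / (ξ - k))) := by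
  classical
  set S : ℂ → ℂ := fun z => ∑ n, res n / (z - a n) with hS
  set g₀ : ℂ → ℂ := fun z => f z - c - S z with hg₀
  -- The singularities of `g₀` at the poles of `f` are removable, and `g` takes the limits as values
  -- there.
  set g : ℂ → ℂ := fun z => if z ∈ Set.range a then limUnder (𝓝[≠] z) g₀ else g₀ z with hg
  have hfin : (Set.range a).Finite := Set.finite_range a
  have hSd : ∀ z, z ∉ Set.range a → DifferentiableAt ℂ S z := fun z hz =>
    DifferentiableAt.fun_sum fun n _ => (differentiableAt_const _).div
      (differentiableAt_id.sub_const _) (sub_ne_zero.2 fun h => hz ⟨n, h.symm⟩)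
  have hg₀d : ∀ z ∉ D.sigma, z ∉ Set.range a → DifferentiableAt ℂ g₀ z := fun z h1 h2 =>
    ((hf z h1 h2).sub_const c).sub (hSd z h2)
  have hgg₀ : ∀ z, z ∉ Set.range a → g =ᶠ[𝓝 z] g₀ := fun z hz => by
    filter_upwards [hfin.isClosed.isOpen_compl.mem_nhds hz] with w hw
    simp only [hg, if_neg hw]
  have hpunct : ∀ n, ∀ᶠ z in 𝓝[≠] (a n), z ∉ Set.range a ∧ z ∉ D.sigma := fun n => by
    have h1 : (Set.range a \ {a n})ᶜ ∈ 𝓝 (a n) :=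
      (hfin.subset Set.sdiff_subset).isClosed.isOpen_compl.mem_nhds (by simp)
    filter_upwards [nhdsWithin_le_nhds h1, self_mem_nhdsWithin, nhdsWithin_le_nhds
      (D.isClosed_sigma.isOpen_compl.mem_nhds (haS n))] with z h2 h3 h4
    exact ⟨fun h => h2 ⟨h, h3⟩, h4⟩
  have hsub : ∀ n, Tendsto (fun z => z - a n) (𝓝[≠] (a n)) (𝓝 0) := fun n => by
    have : Tendsto (fun z => z - a n) (𝓝 (a n)) (𝓝 (a n - a n)) := tendsto_id.sub_const _
    rw [sub_self] at this
    exact this.mono_left nhdsWithin_le_nhds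
  have hlim : ∀ n, Tendsto (fun z => (z - a n) * g₀ z) (𝓝[≠] (a n)) (𝓝 0) := fun n => by
    have hs : Tendsto (fun z => ∑ m, (z - a n) * (res m / (z - a m))) (𝓝[≠] (a n))
        (𝓝 (∑ m, if m = n then res n else 0)) := by
      refine tendsto_finsetSum _ fun m _ => ?_
      split_ifs with hmn
      · subst hmn
        refine tendsto_const_nhds.congr' ?_
        filter_upwards [self_mem_nhdsWithin] with z hz
        rw [mul_div_cancel₀ _ (sub_ne_zero.2 hz)]
      · have hne : a n - a m ≠ 0 := sub_ne_zero.2 fun h => hmn (ha h).symm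
        have : Tendsto (fun z => res m / (z - a m)) (𝓝[≠] (a n)) (𝓝 (res m / (a n - a m))) :=
          (tendsto_const_nhds.div (tendsto_id.sub_const _) hne).mono_left nhdsWithin_le_nhds
        simpa using (hsub n).mul this
    have := ((hres n).sub ((hsub n).mul_const c)).sub hs
    simp only [Finset.sum_ite_eq', Finset.mem_univ, if_true, zero_mul, sub_zero, sub_self] at this
    refine this.congr fun z => ?_
    simp only [hg₀, hS, ← Finset.mul_sum]
    ring
  have hgd : DifferentiableOn ℂ g D.sigmaᶜ := by
    intro z hz
    refine DifferentiableAt.differentiableWithinAt ?_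
    by_cases hza : z ∈ Set.range a
    · obtain ⟨n, rfl⟩ := hza
      have hd : ∀ᶠ z in 𝓝[≠] (a n), DifferentiableAt ℂ g₀ z :=
        (hpunct n).mono fun z hz => hg₀d z hz.2 hz.1
      -- Riemann's criterion: `(z - a n) g₀ z` tends to zero because the residue has been
      -- subtracted.
      have ho : (fun z => g₀ z - g₀ (a n)) =o[𝓝[≠] (a n)] fun z => (z - a n)⁻¹ := by
        rw [isLittleO_iff_tendsto' (by
          filter_upwards [self_mem_nhdsWithin] with z hz h
          exact absurd (inv_eq_zero.1 h) (sub_ne_zero.2 hz))]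
        have := (hlim n).sub ((hsub n).mul_const (g₀ (a n)))
        simp only [zero_mul, sub_zero] at this
        refine this.congr fun z => ?_
        rw [div_inv_eq_mul]
        ring
      have hl := Complex.tendsto_limUnder_of_differentiable_on_punctured_nhds_of_isLittleO hd ho
      refine (Complex.analyticAt_of_differentiable_on_punctured_nhds_of_continuousAt
        ((hpunct n).mono fun z hz => ?_) ?_).differentiableAt
      · exact (hgg₀ z hz.1).differentiableAt_iff.2 (hg₀d z hz.2 hz.1)
      · rw [continuousAt_iff_punctured_nhds]
        have : g (a n) = limUnder (𝓝[≠] (a n)) g₀ := by simp [hg]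
        rw [this]
        refine hl.congr' ?_
        filter_upwards [hpunct n] with z hz
        simp only [hg, if_neg hz.1]
    · exact (hgg₀ z hza).differentiableAt_iff.2 (hg₀d z hz hza)
  have hSa : ∀ z ∈ D.sigma, z ∉ Set.range a := by
    rintro z hz ⟨n, rfl⟩
    exact haS n hz
  have lim : ∀ {ξ : ℂ} {l : Filter ℂ} {b : ℂ}, ξ ∈ D.sigma → l ≤ 𝓝 ξ → Tendsto f l (𝓝 b) →
      Tendsto g l (𝓝 (b - c - S ξ)) := fun {ξ l b} hξ hl h =>
    (((h.sub_const c).sub ((hSd ξ (hSa ξ hξ)).continuousAt.tendsto.mono_left hl))).congr'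
      ((hgg₀ ξ (hSa ξ hξ)).filter_mono hl).symm
  have hgb : D.HasBoundaryValues g (fun ξ => fp ξ - c - S ξ) (fun ξ => fm ξ - c - S ξ) :=
    ⟨fun ξ hξ => lim (mem_sigma_of_mem (Or.inl hξ)) nhdsWithin_le_nhds (hb.left_real ξ hξ),
      fun ξ hξ => lim (mem_sigma_of_mem (Or.inl hξ)) nhdsWithin_le_nhds (hb.right_real ξ hξ),
      fun ξ hξ => lim (mem_sigma_of_mem (Or.inr hξ)) nhdsWithin_le_nhds (hb.left_cuts ξ hξ),
      fun ξ hξ => lim (mem_sigma_of_mem (Or.inr hξ)) nhdsWithin_le_nhds (hb.right_cuts ξ hξ)⟩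
  have hloc : ∀ z, g =O[𝓝[D.sigmaᶜ] z] D.weight := by
    intro z
    by_cases hz : z ∈ D.sigma
    · rcases mem_of_mem_sigma hz with h | h
      · exact hgb.isBigO_weight h
      · have h1 : S =O[𝓝[D.sigmaᶜ] z] D.weight := isBigO_weight_of_tendsto
          ((hSd z (hSa z hz)).continuousAt.tendsto.mono_left nhdsWithin_le_nhds)
        have h2 : (fun _ : ℂ => c) =O[𝓝[D.sigmaᶜ] z] D.weight :=
          isBigO_weight_of_tendsto tendsto_const_nhds
        exact (((hW z h).sub h2).sub h1).congr'
          ((hgg₀ z (hSa z hz)).filter_mono nhdsWithin_le_nhds).symm EventuallyEq.rfl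
    · exact isBigO_weight_of_tendsto ((hgd z hz).continuousWithinAt.tendsto)
  have hginf : g =O[Bornology.cobounded ℂ ⊓ 𝓟 D.sigmaᶜ] (fun z => z⁻¹) := by
    have h1 : S =O[Bornology.cobounded ℂ] (fun z => z⁻¹) :=
      IsBigO.fun_sum fun n _ => isBigO_div_sub_cobounded (res n) (a n)
    refine (hinf.sub (h1.mono inf_le_left)).congr' ?_ EventuallyEq.rfl
    -- Boundedness of a set means by definition that its complement belongs to `cobounded`.
    have : ∀ᶠ z in Bornology.cobounded ℂ, z ∉ Set.range a := hfin.isBounded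
    filter_upwards [this.filter_mono inf_le_left] with z hz
    simp only [hg, if_neg hz, hg₀]
  obtain ⟨C, hC, hCb⟩ := exists_norm_le_weight hloc hginf
  obtain ⟨hi, he⟩ := D.cauchy_of_norm_le hV hp hm hgd hgb hC hCb hk
  -- The constant and the principal parts are continuous across the contour and do not affect the
  -- jump.
  have hfun : (fun ξ => (fp ξ - c - S ξ - (fm ξ - c - S ξ)) / (ξ - k)) =
      fun ξ => (fp ξ - fm ξ) / (ξ - k) := by
    funext ξ
    congr 1
    ring
  rw [hfun] at hi he
  refine ⟨hi, fun hka => ?_⟩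
  have hpi : (2 * Real.pi * Complex.I : ℂ) ≠ 0 := Complex.two_pi_I_ne_zero
  rw [he, inv_mul_cancel_left₀ hpi]
  simp only [hg, if_neg hka, hg₀]
  ring

end Data

/-! ### Application to the Riemann-Hilbert problem -/

namespace IsSolution

variable {D : Data} {x t : ℝ} {M Mp Mm : ℂ → Matrix (Fin 2) (Fin 2) ℂ}

theorem hasBoundaryValues (hM : IsSolution D x t M Mp Mm) (i j : Fin 2) :
    D.HasBoundaryValues (fun z => M z i j) (fun z => Mp z i j) (fun z => Mm z i j) := by
  have key : ∀ {l : Filter ℂ} {L : Matrix (Fin 2) (Fin 2) ℂ}, Tendsto M l (𝓝 L) →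
      Tendsto (fun z => M z i j) l (𝓝 (L i j)) := fun {l L} h =>
    ((continuous_id.matrix_elem i j).tendsto L).comp h
  exact ⟨fun z hz => key (hM.left_real z hz), fun z hz => key (hM.right_real z hz),
    fun z hz => key (hM.left_cuts z hz), fun z hz => key (hM.right_cuts z hz)⟩

theorem isBigO_of_tendsto_mul_root {l : Filter ℂ} {q : ℂ} {root : ℂ → ℂ} {f : ℂ → ℂ} {L : ℂ}
    (hroot : ∀ z, ‖root z‖ = ‖z‖ ^ (1 / 4 : ℝ)) (hl : ∀ᶠ z in l, z ≠ q)
    (h : Tendsto (fun z => f z * root (z - q)) l (𝓝 L)) :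
    f =O[l] fun z => ‖z - q‖ ^ (-(1 / 4) : ℝ) := by
  have h1 : (fun z => (root (z - q))⁻¹) =O[l] fun z => ‖z - q‖ ^ (-(1 / 4) : ℝ) :=
    IsBigO.of_bound 1 (Eventually.of_forall fun z => by
      rw [norm_inv, hroot, Real.rpow_neg (norm_nonneg _), one_mul, Real.norm_of_nonneg]
      positivity)
  have h2 := (h.isBigO_one ℝ).mul h1
  simp only [one_mul] at h2
  refine h2.congr' ?_ EventuallyEq.rfl
  filter_upwards [hl] with z hz
  have : root (z - q) ≠ 0 := by
    rw [← norm_pos_iff, hroot]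
    exact Real.rpow_pos_of_pos (norm_pos_iff.2 (sub_ne_zero.2 hz)) _
  field_simp

/-- Here `f` is a bounded function times the root, which is itself bounded near `q`. The point `q`
is kept out of `s` because the root vanishes there and cannot be cancelled against its inverse. -/
theorem isBigO_of_tendsto_mul_inv_root {q : ℂ} {s : Set ℂ} {root : ℂ → ℂ} {f : ℂ → ℂ} {L : ℂ}
    (hroot : ∀ z, ‖root z‖ = ‖z‖ ^ (1 / 4 : ℝ)) (hl : q ∉ s)
    (h : Tendsto (fun z => f z * (root (z - q))⁻¹) (𝓝[s] q) (𝓝 L)) :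
    f =O[𝓝[s] q] fun _ => (1 : ℝ) := by
  have h1 : (fun z => root (z - q)) =O[𝓝[s] q] fun _ => (1 : ℝ) := by
    have : Tendsto (fun z : ℂ => ‖z - q‖ ^ (1 / 4 : ℝ)) (𝓝[s] q) (𝓝 (‖q - q‖ ^ (1 / 4 : ℝ))) :=
      (((continuous_id.sub continuous_const).norm.rpow_const fun _ => Or.inr
        (by norm_num)).tendsto q).mono_left nhdsWithin_le_nhds
    refine (IsBigO.of_bound 1 (Eventually.of_forall fun z => ?_)).trans (this.isBigO_one ℝ)
    rw [hroot, one_mul]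
    exact le_abs_self _
  have h2 := (h.isBigO_one ℝ).mul h1
  simp only [one_mul] at h2
  refine h2.congr' ?_ EventuallyEq.rfl
  filter_upwards [self_mem_nhdsWithin] with z hz
  have : root (z - q) ≠ 0 := by
    rw [← norm_pos_iff, hroot]
    exact Real.rpow_pos_of_pos (norm_pos_iff.2 (sub_ne_zero.2 fun h => hl ((show z = q from h) ▸ hz))) _
  field_simp

/-- At `p₊` the first column may grow like the power `-1/4` while the second stays bounded; at `conj
p₊` the columns exchange roles. At the other four singular points `M` is bounded. -/
theorem isBigO_weight (hM : IsSolution D x t M Mp Mm) (hp : 0 < D.Ap) (i j : Fin 2) :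
    ∀ z ∈ D.singularPoints, (fun z => M z i j) =O[𝓝[D.sigmaᶜ] z] D.weight := by
  have key : ∀ {l : Filter ℂ} {F : ℂ → Matrix (Fin 2) (Fin 2) ℂ} {L : Matrix (Fin 2) (Fin 2) ℂ}
      (j : Fin 2), Tendsto F l (𝓝 L) → Tendsto (fun z => F z i j) l (𝓝 (L i j)) :=
    fun {l F L} j h => ((continuous_id.matrix_elem i j).tendsto L).comp h
  have hcross : ∀ q ∈ ({-(D.V / 2 : ℂ), (D.V / 2 : ℂ)} : Set ℂ),
      (fun z => M z i j) =O[𝓝[D.sigmaᶜ] q] D.weight := fun q hq => by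
    obtain ⟨B, hB⟩ := hM.crossing q hq
    refine Data.isBigO_weight_of_isBigO_one (IsBigO.of_bound B ?_)
    filter_upwards [hB] with z hz
    simpa using hz i j
  have hpS : D.pPlus ∈ D.sigma := Or.inl (Or.inr ⟨by simp, by simp [abs_of_pos hp]⟩)
  have hpS' : conj D.pPlus ∈ D.sigma := Or.inl (Or.inr ⟨by simp, by simp [abs_of_pos hp]⟩)
  have w1 : ∀ l : Filter ℂ, (fun z => ‖z - D.pPlus‖ ^ (-(1 / 4) : ℝ)) =O[l] D.weight := fun l =>
    IsBigO.of_bound 1 (Eventually.of_forall fun z => by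
      rw [Real.norm_of_nonneg (by positivity), Real.norm_of_nonneg (D.weight_pos z).le, one_mul]
      have : 0 ≤ ‖z - conj D.pPlus‖ ^ (-(1 / 4) : ℝ) := by positivity
      unfold Data.weight
      linarith)
  have w2 : ∀ l : Filter ℂ, (fun z => ‖z - conj D.pPlus‖ ^ (-(1 / 4) : ℝ)) =O[l] D.weight :=
    fun l => IsBigO.of_bound 1 (Eventually.of_forall fun z => by
      rw [Real.norm_of_nonneg (by positivity), Real.norm_of_nonneg (D.weight_pos z).le, one_mul]
      have : 0 ≤ ‖z - D.pPlus‖ ^ (-(1 / 4) : ℝ) := by positivity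
      unfold Data.weight
      linarith)
  have hne : ∀ {q : ℂ}, q ∈ D.sigma → ∀ᶠ z in 𝓝[D.sigmaᶜ] q, z ≠ q := fun {q} hq => by
    filter_upwards [self_mem_nhdsWithin] with z hz h
    exact hz (h ▸ hq)
  rintro z (rfl | rfl | rfl | rfl | hz)
  · obtain ⟨L, hL⟩ := hM.growth_pPlus
    have h0 := key 0 hL
    have h1 := key 1 hL
    simp only [Matrix.mul_apply, Fin.sum_univ_two, Matrix.of_apply, Matrix.cons_val', Matrix.cons_val_zero,
      Matrix.cons_val_one, Matrix.cons_val_fin_one, mul_zero, add_zero, zero_add] at h0 h1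
    fin_cases j
    · exact (isBigO_of_tendsto_mul_root norm_rootDown (hne hpS) h0).trans (w1 _)
    · exact Data.isBigO_weight_of_isBigO_one
        (isBigO_of_tendsto_mul_inv_root norm_rootDown (fun h => h hpS) h1)
  · obtain ⟨L, hL⟩ := hM.growth_pPlus_conj
    have h0 := key 0 hL
    have h1 := key 1 hL
    simp only [Matrix.mul_apply, Fin.sum_univ_two, Matrix.of_apply, Matrix.cons_val', Matrix.cons_val_zero,
      Matrix.cons_val_one, Matrix.cons_val_fin_one, mul_zero, add_zero, zero_add] at h0 h1
    fin_cases j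
    · exact Data.isBigO_weight_of_isBigO_one
        (isBigO_of_tendsto_mul_inv_root norm_rootUp (fun h => h hpS') h0)
    · exact (isBigO_of_tendsto_mul_root norm_rootUp (hne hpS') h1).trans (w2 _)
  · obtain ⟨L, hL⟩ := hM.growth_pMinus
    exact Data.isBigO_weight_of_tendsto (key j hL)
  · obtain ⟨L, hL⟩ := hM.growth_pMinus_conj
    exact Data.isBigO_weight_of_tendsto (key j hL)
  · exact hcross z hz

theorem kernel_eq (hM : IsSolution D x t M Mp Mm) (k : ℂ) (i j : Fin 2) :
    ∀ ξ ∈ D.realPart ∪ D.cuts, (Mp ξ i j - Mm ξ i j) / (ξ - k) = D.kernel x t Mm k i j ξ := by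
  intro ξ hξ
  rw [Data.kernel, mul_sub, ← hM.jump ξ hξ, mul_one, Matrix.sub_apply]

theorem conj_notMem_sigma {z : ℂ} (hz : z ∉ D.sigma) : conj z ∉ D.sigma := by
  rw [Data.notMem_sigma_iff] at hz ⊢
  simpa using hz

/-- Cauchy's formula for the entries of the first column. -/
theorem entry_zero (hD : D.Admissible) (hM : IsSolution D x t M Mp Mm) (i : Fin 2) {k : ℂ}
    (hk : k ∉ D.sigma) : D.ContourIntegrable (D.kernel x t Mm k i 0) ∧
      (k ∉ Set.range (fun n => conj (D.ev n)) → M k i 0 = (1 : Matrix (Fin 2) (Fin 2) ℂ) i 0 +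
        ∑ n, -D.coeffConj x t n * M (conj (D.ev n)) i 1 / (k - conj (D.ev n)) +
        D.cauchy x t Mm k i 0) := by
  obtain ⟨h1, h2⟩ := Data.cauchy_of_simple_poles hD.V_ne hD.Ap_pos hD.Am_pos
    (a := fun n => conj (D.ev n)) (res := fun n => -D.coeffConj x t n * M (conj (D.ev n)) i 1)
    (fun m n h => hD.ev_injective ((starRingEnd ℂ).injective h))
    (fun n => conj_notMem_sigma (hD.ev_notMem n))
    (fun z hz hz' => by
      by_cases h : z ∈ Set.range D.ev
      · obtain ⟨n, rfl⟩ := h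
        exact (hM.regular_ev n i).differentiableAt
      · exact (hM.analytic i 0 z (by
          rintro (h1 | h1 | h1)
          exacts [hz h1, h h1, hz' h1])).differentiableAt)
    (fun n => by
      have := hM.residue_conj n i
      rwa [neg_mul (conj (D.c n))] at this)
    (hM.hasBoundaryValues i 0) (hM.isBigO_weight hD.Ap_pos i 0) (hM.normalization i 0) hk
  refine ⟨h1.congr hD.Ap_pos hD.Am_pos (hM.kernel_eq k i 0), fun hk' => ?_⟩
  rw [h2 hk', Data.contourIntegral_congr hD.Ap_pos hD.Am_pos (hM.kernel_eq k i 0)]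
  rfl

/-- Cauchy's formula for the entries of the second column. -/
theorem entry_one (hD : D.Admissible) (hM : IsSolution D x t M Mp Mm) (i : Fin 2) {k : ℂ}
    (hk : k ∉ D.sigma) : D.ContourIntegrable (D.kernel x t Mm k i 1) ∧
      (k ∉ Set.range D.ev → M k i 1 = (1 : Matrix (Fin 2) (Fin 2) ℂ) i 1 +
        ∑ n, D.coeff x t n * M (D.ev n) i 0 / (k - D.ev n) + D.cauchy x t Mm k i 1) := by
  obtain ⟨h1, h2⟩ := Data.cauchy_of_simple_poles hD.V_ne hD.Ap_pos hD.Am_pos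
    (a := D.ev) (res := fun n => D.coeff x t n * M (D.ev n) i 0)
    hD.ev_injective hD.ev_notMem
    (fun z hz hz' => by
      by_cases h : z ∈ Set.range (fun n => conj (D.ev n))
      · obtain ⟨n, rfl⟩ := h
        exact (hM.regular_conj n i).differentiableAt
      · exact (hM.analytic i 1 z (by
          rintro (h1 | h1 | h1)
          exacts [hz h1, hz' h1, h h1])).differentiableAt)
    (fun n => hM.residue_ev n i)
    (hM.hasBoundaryValues i 1) (hM.isBigO_weight hD.Ap_pos i 1) (hM.normalization i 1) hk
  refine ⟨h1.congr hD.Ap_pos hD.Am_pos (hM.kernel_eq k i 1), fun hk' => ?_⟩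
  rw [h2 hk', Data.contourIntegral_congr hD.Ap_pos hD.Am_pos (hM.kernel_eq k i 1)]
  rfl

end IsSolution

end PlaneWaveRHP

end

theorem theoremt (D : PlaneWaveRHP.Data) (hD : D.Admissible) (x t : ℝ)
    (M Mp Mm : ℂ → Matrix (Fin 2) (Fin 2) ℂ)
    (hM : PlaneWaveRHP.IsSolution D x t M Mp Mm) :
    (∀ k ∉ D.sigma, ∀ i j, D.ContourIntegrable (D.kernel x t Mm k i j)) ∧
    (∀ k ∉ D.sigma ∪ D.spec,
      M k = 1
        + ∑ n, Matrix.of (fun i j =>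
            (![-D.coeffConj x t n * M (conj (D.ev n)) i 1 / (k - conj (D.ev n)),
               D.coeff x t n * M (D.ev n) i 0 / (k - D.ev n)] : Fin 2 → ℂ) j)
        + D.cauchy x t Mm k) ∧
    (∀ n, (M (D.ev n)).col 0 = ![1, 0]
        - ∑ m, (D.coeffConj x t m / (D.ev n - conj (D.ev m))) • (M (conj (D.ev m))).col 1
        + (D.cauchy x t Mm (D.ev n)).col 0) ∧
    (∀ n, (M (conj (D.ev n))).col 1 = ![0, 1]
        + ∑ m, (D.coeff x t m / (conj (D.ev n) - D.ev m)) • (M (D.ev m)).col 0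
        + (D.cauchy x t Mm (conj (D.ev n))).col 1) := by
  -- The poles of the two columns lie in opposite half planes, so the formula for each column holds
  -- at the poles of the other.
  have hne : ∀ m n, conj (D.ev m) ≠ D.ev n := fun m n h => by
    have h1 := congrArg Complex.im h
    rw [Complex.conj_im] at h1
    linarith [hD.ev_im_pos m, hD.ev_im_pos n]
  refine ⟨fun k hk i j => ?_, fun k hk => ?_, fun n => ?_, fun n => ?_⟩
  · fin_cases j
    · exact (hM.entry_zero hD i hk).1
    · exact (hM.entry_one hD i hk).1
  · ext i j
    rw [Matrix.add_apply, Matrix.add_apply, Matrix.sum_apply]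
    fin_cases j
    · exact (hM.entry_zero hD i fun h => hk (Or.inl h)).2 fun h => hk (Or.inr (Or.inr h))
    · exact (hM.entry_one hD i fun h => hk (Or.inl h)).2 fun h => hk (Or.inr (Or.inl h))
  · funext i
    have h := (hM.entry_zero hD i (hD.ev_notMem n)).2 (by rintro ⟨m, hm⟩; exact hne m n hm)
    rw [Pi.add_apply, Pi.sub_apply, Finset.sum_apply]
    simp only [Matrix.col_apply, Pi.smul_apply, smul_eq_mul]
    rw [h, sub_eq_add_neg, ← Finset.sum_neg_distrib]
    congr 2
    · fin_cases i <;> rfl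
    · exact Finset.sum_congr rfl fun m _ => by ring
  · funext i
    have h := (hM.entry_one hD i (PlaneWaveRHP.IsSolution.conj_notMem_sigma (hD.ev_notMem n))).2
      (by rintro ⟨m, hm⟩; exact hne n m hm.symm)
    rw [Pi.add_apply, Pi.add_apply, Finset.sum_apply]
    simp only [Matrix.col_apply, Pi.smul_apply, smul_eq_mul]
    rw [h]
    congr 2
    · fin_cases i <;> rfl
    · exact Finset.sum_congr rfl fun m _ => by ring
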